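/- Let $f\in\mathbb{R}[x]$ be a polynomial of odd degree $d$ with $f(x)>0$ for all real $x\ge 0$. The double series $$\zeta_f(s)=\sum_{n,m\ge 1}\left(n\,m^{d+1} f\!\left(\tfrac{n}{m}\right)\right)^{-s}$$ converges absolutely for $\Re(s)>\frac{2}{d+2}$ and has a meromorphic continuation to $\mathbb{C}$, again denoted $\zeta_f$. For every non-negative integer $n$, the function $\zeta_f$ is analytic at $s=-2n-1$, and $$\zeta_f(-2n-1)=0.$$ -/

import Mathlib

/-- The general term `(n m^(d+1) f(n/m))^(-s)`, with `d = deg f` and `n, m ≥ 1`, of the double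
Dirichlet series attached to a real polynomial `f`. When `f` is positive on `[0, ∞)` the base is a
positive real number, so this is the usual power (principal branch, real logarithm). -/
noncomputable def zetaPolyTerm (f : Polynomial ℝ) (s : ℂ) (p : ℕ+ × ℕ+) : ℂ :=
  (((p.1 : ℝ) * (p.2 : ℝ) ^ (f.natDegree + 1) * f.eval ((p.1 : ℝ) / (p.2 : ℝ)) : ℝ) : ℂ) ^ (-s)

/-- `Z` is the zeta function `ζ_f` of the real polynomial `f`, continued to the complex plane:
on the half-plane `Re s > 2 / (d + 2)` it is the sum of the (absolutely convergent) double series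
`∑_{n, m ≥ 1} (n m^(d+1) f(n/m))^(-s)`, and it is meromorphic on all of `ℂ`. The normal form
`MeromorphicNFOn` says in addition that removable singularities have been removed (`Z` is analytic,
and so takes its correct value, wherever it has no pole); it makes `Z` unique. -/
structure IsZetaPoly (f : Polynomial ℝ) (Z : ℂ → ℂ) : Prop where
  hasSum : ∀ s : ℂ, 2 / ((f.natDegree : ℝ) + 2) < s.re → HasSum (zetaPolyTerm f s) (Z s)
  meromorphic : MeromorphicNFOn Z Set.univ

/-!
Write `d = deg f` and `p = X * f`. The base of the general term is homogeneous of degree `d + 2` in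
`(n, m)`, and equals `m ^ (d + 2) * p (n / m)`. The series is cut along the diagonal into the parts
`n ≥ m` and `n ≤ m`, each receiving half of the diagonal terms; exchanging the variables replaces `f`
by its reverse polynomial, so it suffices to treat the part `n ≥ m` (`halfSum`).

For fixed `m` the sum over `n ≥ m` stays away from the singularity of `(x m^(d+1) f(x/m)) ^ (-s)` at
`x = 0`, and the Euler-Maclaurin formula applies with uniform bounds. By homogeneity, its terms are
pure powers of `m`, and summing over `m` gives (`halfSum_eq_halfCont`), with `g = p ^ (-s)`,

`ζ((d+2)s - 1) ∫_1^∞ g(t) dt - ∑_k (-1)^k (B_(k+2) / (k+2)!) g^(k+1)(1) ζ((d+2)s + k + 1) + R(s)`,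

where the remainder `R` is holomorphic on a half-plane that grows with the order of the expansion. The
integral is continued meromorphically by the substitution `t = 1 / x` and repeated integration by
parts (`tailCont`). The continuations to the various half-planes are glued with the identity theorem.

Now let `s = -N` with `N` odd. Then `g = p ^ N` is a polynomial of degree `(d + 1) N`, so that `R(s)`
vanishes for a high order of the expansion. Since `d` is odd, `(d + 2) N` is odd. The Bernoulli numbers
of odd index vanish, and every remaining zeta value is at an even integer: it is a trivial zero, unless
`k + 1 ≥ (d + 2) N`, in which case `g^(k+1) = 0`. The integral is regular at `s = -N`, as the residue of
its possible pole contains a vanishing derivative of a polynomial (`tendsto_tailCont_mul`). So the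
continued function tends to `0` at `s = -N` (`tendsto_halfCont`).
-/

/-! ### Derivatives of complex powers of a polynomial -/

section

open Polynomial

/-- The numerator of the `k`-th derivative of `p ^ (-s)`: the polynomial `Q` such that this derivative
is `Q * p ^ (-s - k)`. Its coefficients are polynomials in `s`. -/
noncomputable def cpowNum (p : ℝ[X]) (s : ℂ) : ℕ → ℂ[X]
  | 0 => 1
  | k + 1 => derivative (cpowNum p s k) * p.map (algebraMap ℝ ℂ) -
      C (s + k) * derivative (p.map (algebraMap ℝ ℂ)) * cpowNum p s k

/-- The `k`-th derivative of `t ↦ p(t) ^ (-s)`, at points `t` where `p(t) > 0`. -/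
noncomputable def cpowDeriv (p : ℝ[X]) (k : ℕ) (s : ℂ) (t : ℝ) : ℂ :=
  (cpowNum p s k).eval (t : ℂ) * ((p.eval t : ℝ) : ℂ) ^ (-s - k)

lemma eval_map_ofReal (p : ℝ[X]) (t : ℝ) :
    (p.map (algebraMap ℝ ℂ)).eval (t : ℂ) = ((p.eval t : ℝ) : ℂ) := by
  rw [eval_map]; exact eval₂_at_apply (algebraMap ℝ ℂ) t

lemma cpowDeriv_zero (p : ℝ[X]) (s : ℂ) (t : ℝ) :
    cpowDeriv p 0 s t = ((p.eval t : ℝ) : ℂ) ^ (-s) := by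
  simp [cpowDeriv, cpowNum]

lemma hasDerivAt_cpowDeriv (p : ℝ[X]) (k : ℕ) (s : ℂ) {t : ℝ} (ht : 0 < p.eval t) :
    HasDerivAt (cpowDeriv p k s) (cpowDeriv p (k + 1) s t) t := by
  have h1 : HasDerivAt (fun z : ℂ => (cpowNum p s k).eval z *
      ((p.map (algebraMap ℝ ℂ)).eval z) ^ (-s - k)) (cpowDeriv p (k + 1) s t) (t : ℂ) := by
    have hs : (p.map (algebraMap ℝ ℂ)).eval (t : ℂ) ∈ Complex.slitPlane := by
      rw [eval_map_ofReal]; exact Complex.ofReal_mem_slitPlane.2 ht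
    have hne : ((p.eval t : ℝ) : ℂ) ≠ 0 := by exact_mod_cast ht.ne'
    refine (((cpowNum p s k).hasDerivAt (t : ℂ)).mul
      (((p.map (algebraMap ℝ ℂ)).hasDerivAt (t : ℂ)).cpow_const
        (c := -s - k) hs)).congr_deriv ?_
    rw [cpowDeriv, cpowNum, eval_map_ofReal]
    have e1 : (-s - ((k + 1 : ℕ) : ℂ)) = -s - k - 1 := by push_cast; ring
    rw [e1, Complex.cpow_sub (-s - k) 1 hne, Complex.cpow_one]
    simp only [eval_sub, eval_mul, eval_C, eval_map_ofReal]
    field_simp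
    ring
  have h2 := h1.comp_ofReal
  simp only [eval_map_ofReal] at h2
  exact h2

lemma continuousAt_cpowDeriv_right (p : ℝ[X]) (k : ℕ) (s : ℂ) {t : ℝ} (ht : 0 < p.eval t) :
    ContinuousAt (cpowDeriv p k s) t := (hasDerivAt_cpowDeriv p k s ht).continuousAt

lemma natDegree_cpowNum_le (p : ℝ[X]) (s : ℂ) (k : ℕ) :
    (cpowNum p s k).natDegree ≤ k * (p.natDegree - 1) := by
  induction k with
  | zero => simp [cpowNum]
  | succ k ih =>
    rw [cpowNum]
    have hp : (p.map (algebraMap ℝ ℂ)).natDegree = p.natDegree := natDegree_map _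
    refine (natDegree_sub_le _ _).trans (max_le ?_ ?_)
    · by_cases h0 : derivative (cpowNum p s k) = 0
      · simp [h0]
      · have h1 : (cpowNum p s k).natDegree ≠ 0 := by
          intro h
          exact h0 (by rw [eq_C_of_natDegree_eq_zero h, derivative_C])
        have h2 := natDegree_derivative_lt h1
        refine natDegree_mul_le.trans ?_
        rw [hp, add_mul]
        omega
    · rw [mul_assoc]
      refine (natDegree_C_mul_le _ _).trans (natDegree_mul_le.trans ?_)
      have := natDegree_derivative_le (p.map (algebraMap ℝ ℂ))
      rw [hp] at this
      rw [add_mul]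
      omega

lemma differentiable_coeff_cpowNum (p : ℝ[X]) (k i : ℕ) :
    Differentiable ℂ (fun s => (cpowNum p s k).coeff i) := by
  induction k generalizing i with
  | zero => simp [cpowNum]
  | succ k ih =>
    have h : ∀ s : ℂ, (cpowNum p s (k + 1)).coeff i =
        ∑ x ∈ Finset.HasAntidiagonal.antidiagonal i, (cpowNum p s k).coeff (x.1 + 1) * ((x.1 : ℂ) + 1) *
          (p.map (algebraMap ℝ ℂ)).coeff x.2 -
        (s + k) * ∑ x ∈ Finset.HasAntidiagonal.antidiagonal i, (derivative (p.map (algebraMap ℝ ℂ))).coeff x.1 *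
          (cpowNum p s k).coeff x.2 := by
      intro s
      rw [cpowNum, coeff_sub, mul_assoc, coeff_C_mul, coeff_mul, coeff_mul]
      simp only [coeff_derivative]
    simp only [h]
    refine Differentiable.sub (Differentiable.fun_sum fun x _ => ?_)
      (Differentiable.mul (by fun_prop) (Differentiable.fun_sum fun x _ => ?_))
    · exact ((ih _).mul_const _).mul_const _
    · exact (ih _).const_mul _

lemma eval_cpowNum_eq_sum (p : ℝ[X]) (s : ℂ) (k : ℕ) (z : ℂ) :
    (cpowNum p s k).eval z =
      ∑ i ∈ Finset.range (k * (p.natDegree - 1) + 1), (cpowNum p s k).coeff i * z ^ i :=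
  eval_eq_sum_range' (Nat.lt_succ_of_le (natDegree_cpowNum_le p s k)) z

lemma continuous_eval_cpowNum (p : ℝ[X]) (k : ℕ) :
    Continuous (fun q : ℂ × ℝ => (cpowNum p q.1 k).eval (q.2 : ℂ)) := by
  simp only [eval_cpowNum_eq_sum]
  refine continuous_finsetSum _ fun i _ => ?_
  exact ((differentiable_coeff_cpowNum p k i).continuous.comp continuous_fst).mul (by fun_prop)

lemma continuousAt_cpowDeriv (p : ℝ[X]) (k : ℕ) (s : ℂ) {t : ℝ} (ht : 0 < p.eval t) :
    ContinuousAt (fun q : ℂ × ℝ => cpowDeriv p k q.1 q.2) (s, t) := by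
  refine (continuous_eval_cpowNum p k).continuousAt.mul ?_
  refine ContinuousAt.cpow ?_ (by fun_prop) (Complex.ofReal_mem_slitPlane.2 ht)
  exact (Complex.continuous_ofReal.comp (p.continuous.comp continuous_snd)).continuousAt

lemma differentiable_cpowDeriv (p : ℝ[X]) (k : ℕ) {t : ℝ} (ht : 0 < p.eval t) :
    Differentiable ℂ (fun s => cpowDeriv p k s t) := by
  have hne : ((p.eval t : ℝ) : ℂ) ≠ 0 := by exact_mod_cast ht.ne'
  unfold cpowDeriv
  refine Differentiable.mul ?_ ?_
  · simp only [eval_cpowNum_eq_sum]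
    refine Differentiable.fun_sum fun i _ => ?_
    exact (differentiable_coeff_cpowNum p k i).mul_const _
  · intro s
    exact DifferentiableAt.const_cpow (by fun_prop) (Or.inl hne)

/-- At `s = -N` the function `p ^ (-s)` is the polynomial `p ^ N`, and `cpowNum` is expressed through
its derivatives. The identity lives in the polynomial ring, so no positivity is needed. -/
lemma iterate_derivative_pow_mul_pow (p : ℝ[X]) (N k : ℕ) :
    derivative^[k] (p.map (algebraMap ℝ ℂ) ^ N) * p.map (algebraMap ℝ ℂ) ^ k =
      cpowNum p (-N) k * p.map (algebraMap ℝ ℂ) ^ N := by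
  set q := p.map (algebraMap ℝ ℂ) with hq
  induction k with
  | zero => simp [cpowNum]
  | succ k ih =>
    have h := congrArg (fun r => derivative r * q) ih
    simp only [derivative_mul, derivative_pow] at h
    have hN : ∀ M : ℕ, (C (M : ℂ) * q ^ (M - 1) * derivative q) * q =
        C (M : ℂ) * q ^ M * derivative q := by
      intro M
      rcases M with _ | M
      · simp
      · simp [pow_succ]; ring
    rw [Function.iterate_succ_apply', cpowNum, ← hq]
    have e1 : derivative (derivative^[k] (q ^ N)) * q ^ (k + 1) =
        (derivative (derivative^[k] (q ^ N)) * q ^ k +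
          derivative^[k] (q ^ N) * (C (k : ℂ) * q ^ (k - 1) * derivative q)) * q -
        C (k : ℂ) * derivative q * (derivative^[k] (q ^ N) * q ^ k) := by
      have := hN k
      linear_combination (-derivative^[k] (q ^ N)) * this
    rw [e1, h, ih]
    have := hN N
    simp only [C_add, C_neg]
    linear_combination (cpowNum p (-N) k) * this

/-- At `s = -N` the derivatives of `p ^ (-s) = p ^ N` of order larger than `N * deg p` vanish. This is
what annihilates all remainder terms at negative integers. -/
lemma cpowNum_neg_nat_eq_zero {p : ℝ[X]} (hp : p ≠ 0) {N k : ℕ} (hk : N * p.natDegree < k) :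
    cpowNum p (-N) k = 0 := by
  have hq : p.map (algebraMap ℝ ℂ) ≠ 0 := by
    rwa [Ne, Polynomial.map_eq_zero]
  have h := iterate_derivative_pow_mul_pow p N k
  rw [iterate_derivative_eq_zero, zero_mul] at h
  · exact (mul_eq_zero.1 h.symm).resolve_right (pow_ne_zero _ hq)
  · rwa [natDegree_pow, natDegree_map]

lemma cpowDeriv_neg_nat_eq_zero {p : ℝ[X]} (hp : p ≠ 0) {N k : ℕ} (hk : N * p.natDegree < k)
    (t : ℝ) : cpowDeriv p k (-N) t = 0 := by
  simp [cpowDeriv, cpowNum_neg_nat_eq_zero hp hk]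

end

/-! ### Parametric integrals and the Euler-Maclaurin formula -/

section

open Set Filter Topology MeasureTheory

/-- An integral over `[0, 1]` of a jointly continuous function that is holomorphic in the parameter is
holomorphic. By Cauchy's estimate the derivative in the parameter is locally bounded, so one may
differentiate under the integral sign. -/
lemma differentiableOn_intervalIntegral_of_continuousOn {F : ℂ → ℝ → ℂ} {U : Set ℂ}
    (hU : IsOpen U) (hc : ContinuousOn (Function.uncurry F) (U ×ˢ Icc (0 : ℝ) 1))
    (hd : ∀ x ∈ Icc (0 : ℝ) 1, DifferentiableOn ℂ (fun s => F s x) U) :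
    DifferentiableOn ℂ (fun s => ∫ x in (0 : ℝ)..1, F s x) U := by
  intro s₀ hs₀
  obtain ⟨r, hr, hrU⟩ := Metric.nhds_basis_closedBall.mem_iff.1 (hU.mem_nhds hs₀)
  obtain ⟨M, hM⟩ := ((isCompact_closedBall s₀ r).prod isCompact_Icc).exists_bound_of_continuousOn
    (hc.mono (prod_mono hrU subset_rfl))
  have hcont : ∀ s ∈ U, ContinuousOn (F s) (Icc 0 1) := fun s hs =>
    hc.comp (f := fun x : ℝ => (s, x)) (by fun_prop) (fun x hx => ⟨hs, hx⟩)
  have h01 : uIoc (0 : ℝ) 1 ⊆ Icc 0 1 := by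
    rw [uIoc_of_le zero_le_one]; exact Ioc_subset_Icc_self
  have hmeas : ∀ s ∈ U, AEStronglyMeasurable (F s) (volume.restrict (uIoc (0 : ℝ) 1)) :=
    fun s hs => ((hcont s hs).mono h01).aestronglyMeasurable measurableSet_uIoc
  have hball : ∀ s ∈ Metric.ball s₀ (r / 2), Metric.closedBall s (r / 2) ⊆ Metric.closedBall s₀ r :=
    fun s hs => Metric.closedBall_subset_closedBall' (by
      have := Metric.mem_ball.1 hs; linarith)
  have hU' : ∀ s ∈ Metric.ball s₀ (r / 2), s ∈ U := fun s hs =>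
    hrU (hball s hs (Metric.mem_closedBall_self (by positivity)))
  have hder : ∀ x ∈ Icc (0 : ℝ) 1, ∀ s ∈ U,
      HasDerivAt (fun s => F s x) (deriv (fun s => F s x) s) s := fun x hx s hs =>
    ((hd x hx).differentiableAt (hU.mem_nhds hs)).hasDerivAt
  have key := intervalIntegral.hasDerivAt_integral_of_dominated_loc_of_deriv_le
    (μ := volume) (a := 0) (b := 1) (F := F) (F' := fun s x => deriv (fun s => F s x) s)
    (x₀ := s₀) (s := Metric.ball s₀ (r / 2)) (bound := fun _ => M / (r / 2))
    (Metric.ball_mem_nhds _ (by positivity))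
    (by filter_upwards [hU.mem_nhds hs₀] with s hs using hmeas s hs)
    ((hcont s₀ hs₀).intervalIntegrable_of_Icc zero_le_one)
    (by
      -- the derivative is a pointwise limit of difference quotients, hence measurable
      obtain ⟨u, hu, hu0⟩ : ∃ u : ℕ → ℂ, (∀ n, u n ≠ 0 ∧ s₀ + u n ∈ U) ∧ Tendsto u atTop (𝓝 0) := by
        refine ⟨fun n => ((r / (n + 1) : ℝ) : ℂ), fun n => ⟨?_, hrU ?_⟩, ?_⟩
        · have : r / ((n : ℝ) + 1) ≠ 0 := by positivity
          exact Complex.ofReal_ne_zero.2 this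
        · rw [Metric.mem_closedBall, dist_eq_norm, add_sub_cancel_left, Complex.norm_real,
            Real.norm_of_nonneg (by positivity)]
          exact div_le_self hr.le (by linarith [Nat.cast_nonneg (α := ℝ) n])
        · have h1 : Tendsto (fun n : ℕ => r / ((n : ℝ) + 1)) atTop (𝓝 0) :=
            tendsto_const_nhds.div_atTop
              (tendsto_atTop_add_const_right _ _ tendsto_natCast_atTop_atTop)
          exact_mod_cast (Complex.continuous_ofReal.tendsto 0).comp h1
      refine aestronglyMeasurable_of_tendsto_ae (u := atTop)
        (f := fun n x => (u n)⁻¹ • (F (s₀ + u n) x - F s₀ x)) (fun n => ?_) ?_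
      · exact ((hmeas _ (hu n).2).sub (hmeas _ hs₀)).const_smul (u n)⁻¹
      · refine (ae_restrict_mem measurableSet_uIoc).mono fun x hx => ?_
        have := (hder x (h01 hx) s₀ hs₀).tendsto_slope_zero
        exact this.comp (tendsto_nhdsWithin_iff.2 ⟨hu0, Eventually.of_forall fun n => (hu n).1⟩))
    (Eventually.of_forall fun x hx s hs => by
      refine Complex.norm_deriv_le_of_forall_mem_sphere_norm_le (by positivity) ?_ ?_
      · exact ((hd x (h01 hx)).mono ((hball s hs).trans hrU)).diffContOnCl_ball subset_rfl
      · intro z hz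
        exact hM (z, x) ⟨hball s hs (Metric.sphere_subset_closedBall hz), h01 hx⟩)
    intervalIntegrable_const
    (Eventually.of_forall fun x hx s hs => hder x (h01 hx) s (hU' s hs))
  exact key.2.differentiableAt.differentiableWithinAt

lemma hasDerivAt_bernoulliFun_div_factorial (k : ℕ) (x : ℝ) :
    HasDerivAt (fun x => ((bernoulliFun (k + 1) x / (k + 1).factorial : ℝ) : ℂ))
      ((bernoulliFun k x / k.factorial : ℝ) : ℂ) x := by
  have h := (hasDerivAt_bernoulliFun (k + 1) x).div_const ((k + 1).factorial : ℝ)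
  refine h.ofReal_comp.congr_deriv (congrArg _ ?_)
  have h1 : (k.factorial : ℝ) ≠ 0 := by positivity
  have h2 : (k : ℝ) + 1 ≠ 0 := by positivity
  rw [Nat.factorial_succ, Nat.add_sub_cancel]
  push_cast
  field_simp

/-- Integration by parts with the normalised Bernoulli polynomials `B_k / k!` on `[0, 1]`. -/
lemma integral_bernoulliFun_mul {u v : ℝ → ℂ} (k : ℕ)
    (hu : ∀ x ∈ Icc (0 : ℝ) 1, HasDerivAt u (v x) x) (hv : ContinuousOn v (Icc 0 1)) :
    ∫ x in (0 : ℝ)..1, ((bernoulliFun k x / k.factorial : ℝ) : ℂ) * u x =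
      ((bernoulliFun (k + 1) 1 / (k + 1).factorial : ℝ) : ℂ) * u 1 -
        ((bernoulliFun (k + 1) 0 / (k + 1).factorial : ℝ) : ℂ) * u 0 -
        ∫ x in (0 : ℝ)..1, ((bernoulliFun (k + 1) x / (k + 1).factorial : ℝ) : ℂ) * v x := by
  have hI : uIcc (0 : ℝ) 1 = Icc 0 1 := uIcc_of_le zero_le_one
  have h := intervalIntegral.integral_mul_deriv_eq_deriv_mul (a := (0 : ℝ)) (b := 1)
    (u := fun x => ((bernoulliFun (k + 1) x / (k + 1).factorial : ℝ) : ℂ)) (v := u)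
    (u' := fun x => ((bernoulliFun k x / k.factorial : ℝ) : ℂ)) (v' := v)
    (fun x _ => hasDerivAt_bernoulliFun_div_factorial k x) (fun x hx => hu x (hI ▸ hx))
    (Continuous.intervalIntegrable (by
      have := continuous_bernoulliFun (k := k)
      fun_prop) _ _) (hv.intervalIntegrable_of_Icc zero_le_one)
  rw [h]; ring

/-- The Euler-Maclaurin formula on one unit interval, for a sequence `u` of functions each of which
is the derivative of the preceding one. -/
lemma trapezoid_eq_integral_add_sum (u : ℕ → ℝ → ℂ)
    (hu : ∀ k, ∀ x ∈ Icc (0 : ℝ) 1, HasDerivAt (u k) (u (k + 1) x) x) (M : ℕ) :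
    (u 0 0 + u 0 1) / 2 = (∫ x in (0 : ℝ)..1, u 0 x) +
      ∑ k ∈ Finset.range M, (-1) ^ k * ((bernoulli (k + 2) / (k + 2).factorial : ℝ) : ℂ) *
        (u (k + 1) 1 - u (k + 1) 0) +
      (-1) ^ M * ∫ x in (0 : ℝ)..1,
        ((bernoulliFun (M + 1) x / (M + 1).factorial : ℝ) : ℂ) * u (M + 1) x := by
  have hc : ∀ k, ContinuousOn (u k) (Icc 0 1) := fun k x hx =>
    (hu k x hx).continuousAt.continuousWithinAt
  induction M with
  | zero =>
    have h := integral_bernoulliFun_mul 0 (hu 0) (hc 1)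
    simp only [bernoulliFun_zero, zero_add, bernoulliFun_one, Nat.factorial_zero,
      Nat.factorial_one, Nat.cast_one, div_one, Complex.ofReal_one, one_mul] at h
    simp only [Finset.range_zero, Finset.sum_empty, zero_add, bernoulliFun_one, pow_zero, one_mul,
      Nat.factorial_one, Nat.cast_one, div_one]
    rw [h]
    push_cast
    ring
  | succ M ih =>
    rw [ih, integral_bernoulliFun_mul (M + 1) (hu (M + 1)) (hc (M + 2)), Finset.sum_range_succ,
      bernoulliFun_endpoints_eq_of_ne_one (by omega : M + 1 + 1 ≠ 1), bernoulliFun_eval_zero]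
    ring

lemma tsum_eq_of_telescoping {a b c : ℕ → ℂ} {ε : ℂ} (hb : Summable b) (hc : Summable c)
    (ha : Tendsto a atTop (𝓝 0)) (h : ∀ j, b j = a j - a (j + 1) + ε * c j) :
    ∑' j, b j = a 0 + ε * ∑' j, c j := by
  have h1 : HasSum (fun j => b j - ε * c j) (∑' j, b j - ε * ∑' j, c j) :=
    hb.hasSum.sub (hc.hasSum.mul_left ε)
  have h2 : Tendsto (fun n => ∑ j ∈ Finset.range n, (b j - ε * c j)) atTop (𝓝 (a 0)) := by
    have e : ∀ n, ∑ j ∈ Finset.range n, (b j - ε * c j) = a 0 - a n := by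
      intro n
      rw [← Finset.sum_range_sub' a n]
      exact Finset.sum_congr rfl fun j _ => by rw [h j]; ring
    simp only [e]
    simpa using tendsto_const_nhds.sub ha
  have := tendsto_nhds_unique h1.tendsto_sum_nat h2
  linear_combination this

end

/-! ### The reverse polynomial and the integral over a ray -/

section

open Polynomial Set Filter Topology MeasureTheory

lemma eval_reverse_inv_mul_pow (f : ℝ[X]) {x : ℝ} (hx : x ≠ 0) :
    f.reverse.eval x⁻¹ * x ^ f.natDegree = f.eval x := by
  let _ := invertibleOfNonzero hx
  have := eval₂_reverse_mul_pow (RingHom.id ℝ) x f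
  rwa [invOf_eq_inv] at this

lemma ne_zero_of_eval_pos {f : ℝ[X]} (hf : ∀ x : ℝ, 0 ≤ x → 0 < f.eval x) : f ≠ 0 := by
  rintro rfl
  simpa using hf 0 le_rfl

/-- Reversal preserves positivity on `[0, ∞)`; at `0` this says that the leading coefficient is
positive. -/
lemma eval_reverse_pos {f : ℝ[X]} (hf : ∀ x : ℝ, 0 ≤ x → 0 < f.eval x) :
    ∀ x : ℝ, 0 ≤ x → 0 < f.reverse.eval x := by
  have hpos : ∀ x : ℝ, 0 < x → 0 < f.reverse.eval x := by
    intro x hx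
    have h := eval_reverse_inv_mul_pow f (inv_ne_zero hx.ne')
    rw [inv_inv] at h
    have h1 := hf x⁻¹ (by positivity)
    rw [← h] at h1
    exact (pos_iff_pos_of_mul_pos h1).2 (by positivity)
  intro x hx
  rcases hx.eq_or_lt with rfl | hx
  · have h0 : 0 ≤ f.reverse.eval 0 :=
      ge_of_tendsto ((f.reverse.continuous.tendsto 0).mono_left nhdsWithin_le_nhds)
        (eventually_nhdsWithin_of_forall (s := Ioi 0) fun x hx => (hpos x hx).le)
    refine lt_of_le_of_ne h0 (Ne.symm ?_)
    rw [← coeff_zero_eq_eval_zero, coeff_zero_reverse]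
    exact leadingCoeff_ne_zero.2 (ne_zero_of_eval_pos hf)
  · exact hpos x hx

lemma natDegree_reverse_eq {f : ℝ[X]} (hf : ∀ x : ℝ, 0 ≤ x → 0 < f.eval x) :
    f.reverse.natDegree = f.natDegree := by
  rw [reverse_natDegree, natTrailingDegree_eq_zero.2, Nat.sub_zero]
  right
  rw [coeff_zero_eq_eval_zero]
  exact (hf 0 le_rfl).ne'

lemma natDegree_X_mul_of_pos {f : ℝ[X]} (hf : ∀ x : ℝ, 0 ≤ x → 0 < f.eval x) :
    (X * f).natDegree = f.natDegree + 1 :=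
  natDegree_X_mul (ne_zero_of_eval_pos hf)

lemma eval_X_mul_pos {f : ℝ[X]} (hf : ∀ x : ℝ, 0 ≤ x → 0 < f.eval x) {t : ℝ} (ht : 0 < t) :
    0 < (X * f).eval t := by
  rw [eval_mul, eval_X]; exact mul_pos ht (hf t ht.le)

lemma eval_X_mul_eq (f : ℝ[X]) {t : ℝ} (ht : 0 < t) :
    (X * f).eval t = t ^ (f.natDegree + 1) * f.reverse.eval t⁻¹ := by
  rw [eval_mul, eval_X, ← eval_reverse_inv_mul_pow f ht.ne']; ring

/-- The exponent `d / 2` is chosen so that the resulting lower bound for the base of the general term,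
`n * m ^ (d + 1) * f (n / m) ≥ c * (n * m) ^ ((d + 2) / 2)`, is symmetric and a product. -/
lemma exists_pos_mul_rpow_le_eval {f : ℝ[X]} (hf : ∀ x : ℝ, 0 ≤ x → 0 < f.eval x) :
    ∃ c : ℝ, 0 < c ∧ c ≤ 1 ∧ ∀ t : ℝ, 0 < t → c * t ^ ((f.natDegree : ℝ) / 2) ≤ f.eval t := by
  have hmin : ∀ g : ℝ[X], (∀ x : ℝ, 0 ≤ x → 0 < g.eval x) →
      ∃ c : ℝ, 0 < c ∧ ∀ x ∈ Icc (0 : ℝ) 1, c ≤ g.eval x := by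
    intro g hg
    obtain ⟨x₀, hx₀, h⟩ := isCompact_Icc.exists_isMinOn (nonempty_Icc.2 zero_le_one)
      (g.continuous.continuousOn (s := Icc (0 : ℝ) 1))
    exact ⟨g.eval x₀, hg x₀ hx₀.1, fun x hx => h hx⟩
  obtain ⟨c₁, hc₁, h₁⟩ := hmin f hf
  obtain ⟨c₂, hc₂, h₂⟩ := hmin f.reverse (eval_reverse_pos hf)
  refine ⟨min 1 (min c₁ c₂), by positivity, min_le_left _ _, fun t ht => ?_⟩
  have hm : 0 < min 1 (min c₁ c₂) := by positivity
  have hd : (0 : ℝ) ≤ f.natDegree := Nat.cast_nonneg _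
  rcases le_total t 1 with h | h
  · calc _ ≤ c₁ * 1 := by
          gcongr
          · exact (min_le_right _ _).trans (min_le_left _ _)
          · exact Real.rpow_le_one ht.le h (by positivity)
      _ ≤ f.eval t := by rw [mul_one]; exact h₁ t ⟨ht.le, h⟩
  · rw [← eval_reverse_inv_mul_pow f ht.ne']
    refine mul_le_mul (((min_le_right _ _).trans (min_le_right _ _)).trans
      (h₂ _ ⟨by positivity, inv_le_one_of_one_le₀ h⟩)) ?_ (by positivity)
      (eval_reverse_pos hf _ (by positivity)).le
    · rw [← Real.rpow_natCast]
      exact Real.rpow_le_rpow_of_exponent_le h (by linarith)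

/-- The `k`-th derivative of `(t f(t)) ^ (-s)` has size `t ^ (-(d + 1) Re s - k)` on `[1, ∞)`, locally
uniformly in `s`: every derivative gains one power of `t`. -/
lemma exists_norm_cpowDeriv_le {f : ℝ[X]} (hf : ∀ x : ℝ, 0 ≤ x → 0 < f.eval x) (k : ℕ) (R : ℝ) :
    ∃ C : ℝ, 0 ≤ C ∧ ∀ s : ℂ, ‖s‖ ≤ R → ∀ t : ℝ, 1 ≤ t →
      ‖cpowDeriv (X * f) k s t‖ ≤ C * t ^ (-((f.natDegree + 1) * s.re) - k) := by
  have hdeg : (X * f).natDegree - 1 = f.natDegree := by rw [natDegree_X_mul_of_pos hf]; rfl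
  obtain ⟨C₁, hC₁⟩ := (isCompact_closedBall (0 : ℂ) R).exists_bound_of_continuousOn
    (f := fun s => ∑ i ∈ Finset.range (k * f.natDegree + 1), ‖(cpowNum (X * f) s k).coeff i‖)
    (Continuous.continuousOn (continuous_finsetSum _ fun i _ =>
      (differentiable_coeff_cpowNum (X * f) k i).continuous.norm))
  have hcont : ContinuousOn (fun q : ℂ × ℝ => ((f.reverse.eval q.2 : ℝ) : ℂ) ^ (-q.1 - k))
      (Metric.closedBall (0 : ℂ) R ×ˢ Icc (0 : ℝ) 1) := by
    intro q hq
    refine ContinuousAt.continuousWithinAt (ContinuousAt.cpow ?_ (by fun_prop)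
      (Complex.ofReal_mem_slitPlane.2 (eval_reverse_pos hf _ hq.2.1)))
    exact (Complex.continuous_ofReal.comp (f.reverse.continuous.comp continuous_snd)).continuousAt
  obtain ⟨C₂, hC₂⟩ := ((isCompact_closedBall (0 : ℂ) R).prod
    isCompact_Icc).exists_bound_of_continuousOn hcont
  refine ⟨|C₁| * |C₂|, by positivity, fun s hs t ht => ?_⟩
  have ht0 : 0 < t := by linarith
  have hs' : s ∈ Metric.closedBall (0 : ℂ) R := by simpa using hs
  have hti : t⁻¹ ∈ Icc (0 : ℝ) 1 := ⟨by positivity, inv_le_one_of_one_le₀ ht⟩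
  have b1 : ‖(cpowNum (X * f) s k).eval (t : ℂ)‖ ≤ |C₁| * t ^ ((k * f.natDegree : ℕ) : ℝ) := by
    rw [eval_cpowNum_eq_sum, hdeg, Real.rpow_natCast]
    calc _ ≤ ∑ i ∈ Finset.range (k * f.natDegree + 1),
            ‖(cpowNum (X * f) s k).coeff i‖ * t ^ (k * f.natDegree) := by
          refine norm_sum_le_of_le _ fun i hi => ?_
          rw [norm_mul, norm_pow, Complex.norm_real, Real.norm_of_nonneg ht0.le]
          gcongr
          exact Nat.lt_succ_iff.1 (Finset.mem_range.1 hi)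
      _ ≤ _ := by
          rw [← Finset.sum_mul]
          gcongr
          exact (le_abs_self _).trans ((Real.norm_eq_abs _).symm.le.trans
            ((hC₁ s hs').trans (le_abs_self _)))
  have b2 : ‖(((X * f).eval t : ℝ) : ℂ) ^ (-s - k)‖ ≤
      |C₂| * t ^ (((f.natDegree : ℝ) + 1) * (-s.re - k)) := by
    have h1 : 0 < f.reverse.eval t⁻¹ := eval_reverse_pos hf _ hti.1
    have h2 := (hC₂ (s, t⁻¹) ⟨hs', hti⟩).trans (le_abs_self _)
    rw [Complex.norm_cpow_eq_rpow_re_of_pos h1] at h2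
    rw [Complex.norm_cpow_eq_rpow_re_of_pos (eval_X_mul_pos hf ht0), eval_X_mul_eq f ht0,
      Real.mul_rpow (by positivity) h1.le, mul_comm]
    have h3 : (-s - (k : ℂ)).re = -s.re - k := by simp
    rw [h3] at h2 ⊢
    refine mul_le_mul h2 (le_of_eq ?_) (by positivity) (by positivity)
    rw [← Real.rpow_natCast, ← Real.rpow_mul ht0.le]
    push_cast; rfl
  rw [cpowDeriv, norm_mul]
  refine (mul_le_mul b1 b2 (norm_nonneg _) (by positivity)).trans (le_of_eq ?_)
  rw [mul_mul_mul_comm, ← Real.rpow_add ht0]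
  congr 2
  push_cast
  ring

/-- The integral `∫_0^1 x ^ ((d + 1) s - 2 + k) φ_k(x) dx`, where `φ_k` is the `k`-th derivative of
`φ ^ (-s)` and `φ` is the reverse of `f`. For `k = 0`, the substitution `t = 1 / x` identifies it
with `∫_1^∞ (t f(t)) ^ (-s) dt`. -/
noncomputable def tailIntegral (f : ℝ[X]) (k : ℕ) (s : ℂ) : ℂ :=
  ∫ x in (0 : ℝ)..1, (x : ℂ) ^ ((f.natDegree + 1) * s - 2 + k) * cpowDeriv f.reverse k s x

lemma continuousAt_tailIntegrand {f : ℝ[X]} (hf : ∀ x : ℝ, 0 ≤ x → 0 < f.eval x) (k : ℕ) {s : ℂ}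
    (hs : 0 < (((f.natDegree : ℂ) + 1) * s - 2 + k).re) {x : ℝ} (hx : 0 ≤ x) :
    ContinuousAt (fun q : ℂ × ℝ => (q.2 : ℂ) ^ ((f.natDegree + 1) * q.1 - 2 + k) *
      cpowDeriv f.reverse k q.1 q.2) (s, x) := by
  refine ContinuousAt.mul ?_ (continuousAt_cpowDeriv _ _ _ (eval_reverse_pos hf x hx))
  exact (Complex.continuousAt_ofReal_cpow x _ (Or.inl hs)).comp
    (f := fun q : ℂ × ℝ => (q.2, (f.natDegree + 1) * q.1 - 2 + (k : ℂ)))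
    (x := (s, x)) (by fun_prop)

lemma differentiableOn_tailIntegral {f : ℝ[X]} (hf : ∀ x : ℝ, 0 ≤ x → 0 < f.eval x) (k : ℕ) :
    DifferentiableOn ℂ (tailIntegral f k)
      {s | 0 < (((f.natDegree : ℂ) + 1) * s - 2 + k).re} := by
  refine differentiableOn_intervalIntegral_of_continuousOn
    (isOpen_lt continuous_const (by fun_prop)) ?_ ?_
  · rintro ⟨s, x⟩ ⟨hs, hx⟩
    exact (continuousAt_tailIntegrand hf k hs hx.1).continuousWithinAt
  · intro x hx s hs
    refine DifferentiableAt.differentiableWithinAt (DifferentiableAt.mul ?_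
      (differentiable_cpowDeriv _ _ (eval_reverse_pos hf x hx.1) s))
    refine DifferentiableAt.const_cpow (by fun_prop) (Or.inr fun h => ?_)
    have hs' : 0 < (((f.natDegree : ℂ) + 1) * s - 2 + k).re := hs
    rw [h] at hs'
    simp at hs'

lemma continuousAt_tailIntegrand_right {f : ℝ[X]} (hf : ∀ x : ℝ, 0 ≤ x → 0 < f.eval x) (k : ℕ)
    {s : ℂ} (hs : 0 < (((f.natDegree : ℂ) + 1) * s - 2 + k).re) {x : ℝ} (hx : 0 ≤ x) :
    ContinuousAt (fun x : ℝ => (x : ℂ) ^ ((f.natDegree + 1) * s - 2 + k) *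
      cpowDeriv f.reverse k s x) x :=
  (continuousAt_tailIntegrand hf k hs hx).comp (f := fun x : ℝ => (s, x)) (by fun_prop)

/-- Integration by parts, for the function `x ^ ((d + 1) s - 1 + k) φ_k(x)`. -/
lemma mul_tailIntegral {f : ℝ[X]} (hf : ∀ x : ℝ, 0 ≤ x → 0 < f.eval x) (k : ℕ) {s : ℂ}
    (hs : 0 < (((f.natDegree : ℂ) + 1) * s - 2 + k).re) :
    ((f.natDegree + 1) * s - 1 + k) * tailIntegral f k s =
      cpowDeriv f.reverse k s 1 - tailIntegral f (k + 1) s := by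
  set z : ℂ := (f.natDegree + 1) * s - 2 + k with hz
  have hz1 : (f.natDegree + 1) * s - 1 + k = z + 1 := by rw [hz]; ring
  have hz2 : (f.natDegree + 1) * s - 2 + (k + 1 : ℕ) = z + 1 := by rw [hz]; push_cast; ring
  have hre : 0 < (z + 1).re := by simp; linarith
  have hint : ∀ j : ℕ, 0 < (((f.natDegree : ℂ) + 1) * s - 2 + j).re →
      IntervalIntegrable (fun x : ℝ => (x : ℂ) ^ ((f.natDegree + 1) * s - 2 + j) *
        cpowDeriv f.reverse j s x) volume 0 1 := fun j hj =>
    ContinuousOn.intervalIntegrable_of_Icc zero_le_one fun x hx =>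
      (continuousAt_tailIntegrand_right hf j hj hx.1).continuousWithinAt
  have h0 := hint k hs
  have h1 := hint (k + 1) (by rw [hz2]; exact hre)
  rw [hz2] at h1
  rw [← hz] at h0
  have key := intervalIntegral.integral_eq_sub_of_hasDerivAt_of_le (a := (0 : ℝ)) (b := 1)
    zero_le_one (f := fun x : ℝ => (x : ℂ) ^ (z + 1) * cpowDeriv f.reverse k s x)
    (f' := fun x => (z + 1) * ((x : ℂ) ^ z * cpowDeriv f.reverse k s x) +
      (x : ℂ) ^ (z + 1) * cpowDeriv f.reverse (k + 1) s x)
    (fun x hx => ContinuousAt.continuousWithinAt (ContinuousAt.mul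
      (Complex.continuousAt_ofReal_cpow_const x _ (Or.inl hre))
      (continuousAt_cpowDeriv_right _ _ _ (eval_reverse_pos hf x hx.1))))
    (fun x hx => by
      have e1 : HasDerivAt (fun x : ℝ => (x : ℂ) ^ (z + 1)) ((z + 1) * (x : ℂ) ^ z) x := by
        have := ((hasDerivAt_id (x : ℂ)).cpow_const (c := z + 1)
          (Complex.ofReal_mem_slitPlane.2 hx.1)).comp_ofReal
        simpa using this
      exact (e1.mul (hasDerivAt_cpowDeriv _ k s (eval_reverse_pos hf x hx.1.le))).congr_deriv
        (by ring))
    ((h0.const_mul _).add h1)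
  rw [intervalIntegral.integral_add (h0.const_mul _) h1,
    intervalIntegral.integral_const_mul] at key
  have hne : z + 1 ≠ 0 := fun h => by rw [h] at hre; simp at hre
  simp only [Complex.ofReal_one, Complex.one_cpow, one_mul, Complex.ofReal_zero,
    Complex.zero_cpow hne, zero_mul, sub_zero] at key
  rw [tailIntegral, tailIntegral, ← hz, hz2, hz1]
  linear_combination key

/-- The result of `K` integrations by parts in `tailIntegral f 0 s`. It is meromorphic on the larger
half-plane on which `tailIntegral f K` is holomorphic. -/
noncomputable def tailCont (f : ℝ[X]) (K : ℕ) (s : ℂ) : ℂ :=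
  ∑ k ∈ Finset.range K, (-1) ^ k * cpowDeriv f.reverse k s 1 /
      ∏ i ∈ Finset.range (k + 1), ((f.natDegree + 1) * s - 1 + i) +
    (-1) ^ K * tailIntegral f K s / ∏ i ∈ Finset.range K, ((f.natDegree + 1) * s - 1 + i)

lemma tailIntegral_zero_eq_tailCont {f : ℝ[X]} (hf : ∀ x : ℝ, 0 ≤ x → 0 < f.eval x) (K : ℕ) {s : ℂ}
    (hs : 0 < (((f.natDegree : ℂ) + 1) * s - 2).re) :
    tailIntegral f 0 s = tailCont f K s := by
  have hre : ∀ i : ℕ, 0 < (((f.natDegree : ℂ) + 1) * s - 2 + i).re := fun i => by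
    rw [Complex.add_re, Complex.natCast_re]; positivity
  have hne : ∀ i : ℕ, ((f.natDegree : ℂ) + 1) * s - 1 + i ≠ 0 := fun i h => by
    have h1 := hre i
    rw [show ((f.natDegree : ℂ) + 1) * s - 2 + i = ((f.natDegree : ℂ) + 1) * s - 1 + i - 1 by ring,
      h] at h1
    norm_num at h1
  induction K with
  | zero => simp [tailCont]
  | succ K ih =>
    rw [ih, tailCont, tailCont, Finset.sum_range_succ]
    have h := mul_tailIntegral hf K (hre K)
    have hP : ∏ i ∈ Finset.range K, (((f.natDegree : ℂ) + 1) * s - 1 + i) ≠ 0 :=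
      Finset.prod_ne_zero_iff.2 fun i _ => hne i
    have hK := hne K
    rw [Finset.prod_range_succ, add_assoc]
    congr 1
    have e : tailIntegral f K s = (cpowDeriv f.reverse K s 1 - tailIntegral f (K + 1) s) /
        (((f.natDegree : ℂ) + 1) * s - 1 + K) := by
      rw [← h]; field_simp
    rw [e, pow_succ]
    field_simp
    ring

/-- The integral `∫_t^∞ (u f(u)) ^ (-s) du`, written after the substitution `u = 1 / x`. Up to sign it
is a primitive of `(t f(t)) ^ (-s)`. -/
noncomputable def tailPrimitive (f : ℝ[X]) (s : ℂ) (t : ℝ) : ℂ :=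
  ∫ x in (0 : ℝ)..t⁻¹, (x : ℂ) ^ ((f.natDegree + 1) * s - 2) * cpowDeriv f.reverse 0 s x

lemma ofReal_pow_cpow {t : ℝ} (ht : 0 < t) (n : ℕ) (c : ℂ) :
    ((t : ℂ) ^ n) ^ c = (t : ℂ) ^ (n * c) := by
  have hne : (t : ℂ) ≠ 0 := by exact_mod_cast ht.ne'
  induction n with
  | zero => simp
  | succ n ih =>
    rw [pow_succ, ← Complex.ofReal_pow, Complex.mul_cpow_ofReal_nonneg (by positivity) ht.le,
      Complex.ofReal_pow, ih, ← Complex.cpow_add _ _ hne]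
    push_cast
    ring_nf

lemma hasDerivAt_tailPrimitive {f : ℝ[X]} (hf : ∀ x : ℝ, 0 ≤ x → 0 < f.eval x) {s : ℂ}
    (hs : 0 < (((f.natDegree : ℂ) + 1) * s - 2).re) {t : ℝ} (ht : 0 < t) :
    HasDerivAt (tailPrimitive f s) (-cpowDeriv (X * f) 0 s t) t := by
  have hc : ∀ x : ℝ, 0 ≤ x → ContinuousAt (fun x : ℝ =>
      (x : ℂ) ^ ((f.natDegree + 1) * s - 2) * cpowDeriv f.reverse 0 s x) x := by
    intro x hx
    simpa using continuousAt_tailIntegrand_right hf 0 (s := s) (by simpa using hs) hx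
  have hti : 0 < t⁻¹ := by positivity
  have h1 := intervalIntegral.integral_hasDerivAt_right (a := 0) (b := t⁻¹)
    (f := fun x : ℝ => (x : ℂ) ^ ((f.natDegree + 1) * s - 2) * cpowDeriv f.reverse 0 s x)
    (ContinuousOn.intervalIntegrable_of_Icc hti.le fun x hx => (hc x hx.1).continuousWithinAt)
    (ContinuousOn.stronglyMeasurableAtFilter (s := Ioi 0) isOpen_Ioi
      (fun x hx => (hc x (le_of_lt hx)).continuousWithinAt) _ hti) (hc _ hti.le)
  refine (h1.scomp t (hasDerivAt_inv ht.ne')).congr_deriv ?_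
  have hp : 0 < f.reverse.eval t⁻¹ := eval_reverse_pos hf _ hti.le
  rw [cpowDeriv_zero, cpowDeriv_zero, eval_X_mul_eq f ht, Complex.ofReal_mul,
    Complex.mul_cpow_ofReal_nonneg (by positivity) hp.le, Complex.ofReal_inv,
    Complex.inv_cpow _ _ (by rw [Complex.arg_ofReal_of_nonneg ht.le]; exact Real.pi_pos.ne),
    Complex.ofReal_pow, ofReal_pow_cpow ht, Complex.real_smul]
  have hne : (t : ℂ) ≠ 0 := by exact_mod_cast ht.ne'
  have e : ((f.natDegree : ℂ) + 1) * s - 2 = -(((f.natDegree + 1 : ℕ) : ℂ) * -s) - (2 : ℕ) := by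
    push_cast; ring
  rw [e, Complex.cpow_sub _ _ hne, Complex.cpow_neg, Complex.cpow_natCast]
  push_cast
  field_simp

lemma tendsto_tailPrimitive {f : ℝ[X]} (hf : ∀ x : ℝ, 0 ≤ x → 0 < f.eval x) {s : ℂ}
    (hs : 0 < (((f.natDegree : ℂ) + 1) * s - 2).re) :
    Tendsto (tailPrimitive f s) atTop (𝓝 0) := by
  have hc : ContinuousOn (fun x : ℝ =>
      (x : ℂ) ^ ((f.natDegree + 1) * s - 2) * cpowDeriv f.reverse 0 s x) (Icc 0 1) := by
    intro x hx
    have := continuousAt_tailIntegrand_right hf 0 (s := s) (by simpa using hs) hx.1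
    simp only [Nat.cast_zero, add_zero] at this
    exact this.continuousWithinAt
  obtain ⟨C, hC⟩ := isCompact_Icc.exists_bound_of_continuousOn hc
  refine squeeze_zero_norm' (a := fun t : ℝ => C * t⁻¹) ?_ (by
    simpa using tendsto_inv_atTop_zero.const_mul C)
  filter_upwards [eventually_ge_atTop 1] with t ht
  have h1 : t⁻¹ ≤ 1 := inv_le_one_of_one_le₀ ht
  have h0 : 0 ≤ t⁻¹ := by positivity
  have := intervalIntegral.norm_integral_le_of_norm_le_const (a := 0) (b := t⁻¹) (C := C)
    (f := fun x : ℝ => (x : ℂ) ^ ((f.natDegree + 1) * s - 2) * cpowDeriv f.reverse 0 s x)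
    (fun x hx => by
      rw [uIoc_of_le h0] at hx
      exact hC x ⟨hx.1.le, hx.2.trans h1⟩)
  rwa [sub_zero, abs_of_nonneg h0] at this

lemma tailPrimitive_one (f : ℝ[X]) (s : ℂ) : tailPrimitive f s 1 = tailIntegral f 0 s := by
  simp [tailPrimitive, tailIntegral]

end

/-! ### Convergence of the double series and its splitting along the diagonal -/

section

open Polynomial Set Filter Topology MeasureTheory

/-- The `k`-th derivative in `x` of `(x m^(d+1) f(x/m)) ^ (-s)`. By homogeneity of the base, of degree
`d + 2` in `(x, m)`, it is `m ^ (-(d+2)s - k)` times the `k`-th derivative of `(t f(t)) ^ (-s)` at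
`t = x / m`. -/
noncomputable def rayDeriv (f : ℝ[X]) (k : ℕ) (s : ℂ) (m x : ℝ) : ℂ :=
  (m : ℂ) ^ (-((f.natDegree + 2) * s) - k) * cpowDeriv (X * f) k s (x / m)

lemma hasDerivAt_rayDeriv {f : ℝ[X]} (hf : ∀ x : ℝ, 0 ≤ x → 0 < f.eval x) (k : ℕ) (s : ℂ)
    {m x : ℝ} (hm : 0 < m) (hx : 0 < x) :
    HasDerivAt (rayDeriv f k s m) (rayDeriv f (k + 1) s m x) x := by
  have h := (hasDerivAt_cpowDeriv (X * f) k s (eval_X_mul_pos hf (div_pos hx hm))).scomp x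
    ((hasDerivAt_id x).div_const m)
  refine (h.const_mul ((m : ℂ) ^ (-((f.natDegree + 2) * s) - k))).congr_deriv ?_
  have hne : (m : ℂ) ≠ 0 := by exact_mod_cast hm.ne'
  have e : -(((f.natDegree : ℂ) + 2) * s) - (k + 1 : ℕ) = -((f.natDegree + 2) * s) - k - 1 := by
    push_cast; ring
  rw [rayDeriv, e, Complex.cpow_sub _ 1 hne, Complex.cpow_one, Complex.real_smul]
  push_cast
  ring

lemma zetaPolyTerm_eq_rayDeriv {f : ℝ[X]} (hf : ∀ x : ℝ, 0 ≤ x → 0 < f.eval x) (s : ℂ)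
    (p : ℕ+ × ℕ+) : zetaPolyTerm f s p = rayDeriv f 0 s (p.2 : ℝ) (p.1 : ℝ) := by
  have h1 : (0 : ℝ) < (p.1 : ℝ) := by exact_mod_cast p.1.pos
  have h2 : (0 : ℝ) < (p.2 : ℝ) := by exact_mod_cast p.2.pos
  have hp := eval_X_mul_pos hf (div_pos h1 h2)
  have e : (p.1 : ℝ) * (p.2 : ℝ) ^ (f.natDegree + 1) * f.eval ((p.1 : ℝ) / (p.2 : ℝ)) =
      (p.2 : ℝ) ^ (f.natDegree + 2) * (X * f).eval ((p.1 : ℝ) / (p.2 : ℝ)) := by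
    rw [eval_mul, eval_X]; field_simp; ring
  rw [zetaPolyTerm, e, rayDeriv, cpowDeriv_zero, Complex.ofReal_mul,
    Complex.mul_cpow_ofReal_nonneg (by positivity) hp.le, Complex.ofReal_pow, ofReal_pow_cpow h2]
  congr 2
  push_cast
  ring

/-- Replacing `f` by its reverse exchanges the two summation variables. -/
lemma rayDeriv_zero_reverse {f : ℝ[X]} (hf : ∀ x : ℝ, 0 ≤ x → 0 < f.eval x) (s : ℂ)
    (n m : ℕ+) : rayDeriv f.reverse 0 s (m : ℝ) (n : ℝ) = rayDeriv f 0 s (n : ℝ) (m : ℝ) := by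
  have h1 : (0 : ℝ) < (n : ℝ) := by exact_mod_cast n.pos
  have h2 : (0 : ℝ) < (m : ℝ) := by exact_mod_cast m.pos
  rw [← zetaPolyTerm_eq_rayDeriv (eval_reverse_pos hf) s (n, m),
    ← zetaPolyTerm_eq_rayDeriv hf s (m, n), zetaPolyTerm, zetaPolyTerm, natDegree_reverse_eq hf]
  congr 2
  have h := eval_reverse_inv_mul_pow f (x := (m : ℝ) / n) (by positivity)
  rw [inv_div] at h
  simp only
  rw [← h, div_pow]
  field_simp
  ring

lemma summable_prod_rpow {β : ℝ} (hβ : 1 < β) :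
    Summable (fun q : ℕ × ℕ => (((q.1 : ℝ) + 1) * ((q.2 : ℝ) + 1)) ^ (-β)) := by
  have h : Summable (fun n : ℕ => ((n : ℝ) + 1) ^ (-β)) := by
    have := (summable_nat_add_iff 1).2 (Real.summable_nat_rpow.2 (by linarith : -β < -1))
    simpa using this
  refine (h.mul_of_nonneg h (fun n => by positivity) (fun n => by positivity)).congr fun q => ?_
  rw [Real.mul_rpow (by positivity) (by positivity)]

/-- The pair `(a, b)` of natural numbers corresponds to the indices `m = a + 1`, `n = b + 1`, in the
order `(n, m)`. -/
def pnatPairEquiv : ℕ × ℕ ≃ ℕ+ × ℕ+ := (Equiv.prodComm ℕ ℕ).trans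
  (Equiv.prodCongr Equiv.pnatEquivNat.symm Equiv.pnatEquivNat.symm)

lemma zetaPolyTerm_pnatPairEquiv {f : ℝ[X]} (hf : ∀ x : ℝ, 0 ≤ x → 0 < f.eval x) (s : ℂ)
    (q : ℕ × ℕ) : zetaPolyTerm f s (pnatPairEquiv q) =
      rayDeriv f 0 s ((q.1 : ℝ) + 1) ((q.2 : ℝ) + 1) := by
  rw [zetaPolyTerm_eq_rayDeriv hf]
  simp [pnatPairEquiv]

lemma exists_norm_zetaPolyTerm_le {f : ℝ[X]} (hf : ∀ x : ℝ, 0 ≤ x → 0 < f.eval x) (R : ℝ) :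
    ∃ C : ℝ, ∀ s : ℂ, ‖s‖ ≤ R → ∀ σ : ℝ, 0 ≤ σ → σ ≤ s.re → ∀ q : ℕ × ℕ,
      ‖zetaPolyTerm f s (pnatPairEquiv q)‖ ≤
        C * (((q.1 : ℝ) + 1) * ((q.2 : ℝ) + 1)) ^ (-(((f.natDegree : ℝ) + 2) / 2 * σ)) := by
  obtain ⟨c, hc, hc1, hcf⟩ := exists_pos_mul_rpow_le_eval hf
  refine ⟨c ^ (-R), fun s hs σ hσ hσs q => ?_⟩
  set p := pnatPairEquiv q with hp
  have e1 : (p.1 : ℝ) = (q.2 : ℝ) + 1 := by simp [hp, pnatPairEquiv]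
  have e2 : (p.2 : ℝ) = (q.1 : ℝ) + 1 := by simp [hp, pnatPairEquiv]
  set n : ℝ := (q.2 : ℝ) + 1 with hn
  set m : ℝ := (q.1 : ℝ) + 1 with hm
  have hn1 : 1 ≤ n := by rw [hn]; linarith [Nat.cast_nonneg (α := ℝ) q.2]
  have hm1 : 1 ≤ m := by rw [hm]; linarith [Nat.cast_nonneg (α := ℝ) q.1]
  have hn0 : 0 < n := by linarith
  have hm0 : 0 < m := by linarith
  have hd : (0 : ℝ) ≤ f.natDegree := Nat.cast_nonneg _
  have hlow : c * (m * n) ^ (((f.natDegree : ℝ) + 2) / 2) ≤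
      n * m ^ (f.natDegree + 1) * f.eval (n / m) := by
    calc _ = n * m ^ (f.natDegree + 1) * (c * (n / m) ^ ((f.natDegree : ℝ) / 2)) := by
          rw [Real.div_rpow hn0.le hm0.le, Real.mul_rpow hm0.le hn0.le,
            show ((f.natDegree : ℝ) + 2) / 2 = (f.natDegree : ℝ) / 2 + 1 by ring,
            Real.rpow_add_one hm0.ne', Real.rpow_add_one hn0.ne', pow_succ]
          have : m ^ f.natDegree = m ^ ((f.natDegree : ℝ) / 2) * m ^ ((f.natDegree : ℝ) / 2) := by
            rw [← Real.rpow_add hm0, add_halves, Real.rpow_natCast]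
          rw [this]
          have : m ^ ((f.natDegree : ℝ) / 2) ≠ 0 := by positivity
          field_simp
      _ ≤ _ := by
          gcongr
          exact hcf _ (by positivity)
  have hL : 0 < c * (m * n) ^ (((f.natDegree : ℝ) + 2) / 2) := by positivity
  have hmn : 1 ≤ m * n := one_le_mul_of_one_le_of_one_le hm1 hn1
  have hre : s.re ≤ R := (Complex.re_le_norm s).trans hs
  rw [zetaPolyTerm, e1, e2, Complex.norm_cpow_eq_rpow_re_of_pos (hL.trans_le hlow), Complex.neg_re]
  calc _ ≤ (c * (m * n) ^ (((f.natDegree : ℝ) + 2) / 2)) ^ (-s.re) :=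
        Real.rpow_le_rpow_of_nonpos hL hlow (by linarith)
    _ = c ^ (-s.re) * (m * n) ^ (-(((f.natDegree : ℝ) + 2) / 2 * s.re)) := by
        rw [Real.mul_rpow hc.le (by positivity), ← Real.rpow_mul (by positivity)]
        ring_nf
    _ ≤ _ := by
        refine mul_le_mul ?_ ?_ (by positivity) (by positivity)
        · exact Real.rpow_le_rpow_of_exponent_ge hc hc1 (by linarith)
        · refine Real.rpow_le_rpow_of_exponent_le hmn ?_
          have := mul_le_mul_of_nonneg_left hσs (by positivity : 0 ≤ ((f.natDegree : ℝ) + 2) / 2)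
          linarith

lemma summable_zetaPolyTerm {f : ℝ[X]} (hf : ∀ x : ℝ, 0 ≤ x → 0 < f.eval x) {s : ℂ}
    (hs : 2 / ((f.natDegree : ℝ) + 2) < s.re) : Summable (zetaPolyTerm f s) := by
  obtain ⟨C, hC⟩ := exists_norm_zetaPolyTerm_le hf ‖s‖
  have hd : (0 : ℝ) < (f.natDegree : ℝ) + 2 := by positivity
  have h1 : 1 < ((f.natDegree : ℝ) + 2) / 2 * s.re := by
    rw [div_lt_iff₀ hd] at hs; linarith
  refine pnatPairEquiv.summable_iff.1 (Summable.of_norm_bounded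
    ((summable_prod_rpow h1).mul_left C) fun q => ?_)
  exact hC s le_rfl s.re ((by positivity : 0 ≤ 2 / ((f.natDegree : ℝ) + 2)).trans hs.le) le_rfl q

lemma differentiableOn_tsum_zetaPolyTerm {f : ℝ[X]} (hf : ∀ x : ℝ, 0 ≤ x → 0 < f.eval x) :
    DifferentiableOn ℂ (fun s => ∑' p, zetaPolyTerm f s p)
      {s | 2 / ((f.natDegree : ℝ) + 2) < s.re} := by
  intro s hs
  obtain ⟨σ, hσ, hσs⟩ := exists_between (show 2 / ((f.natDegree : ℝ) + 2) < s.re from hs)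
  obtain ⟨C, hC⟩ := exists_norm_zetaPolyTerm_le hf (‖s‖ + 1)
  have hd : (0 : ℝ) < (f.natDegree : ℝ) + 2 := by positivity
  have h1 : 1 < ((f.natDegree : ℝ) + 2) / 2 * σ := by
    rw [div_lt_iff₀ hd] at hσ; linarith
  have hσ0 : 0 ≤ σ := (by positivity : 0 ≤ 2 / ((f.natDegree : ℝ) + 2)).trans hσ.le
  have hV : IsOpen {z : ℂ | ‖z‖ < ‖s‖ + 1 ∧ σ < z.re} :=
    (isOpen_lt continuous_norm continuous_const).inter
      (isOpen_lt continuous_const Complex.continuous_re)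
  have h := Complex.differentiableOn_tsum_of_summable_norm
    (F := fun (q : ℕ × ℕ) z => zetaPolyTerm f z (pnatPairEquiv q))
    ((summable_prod_rpow h1).mul_left C) (fun q z _ => ?_) hV
    (fun q z hz => hC z hz.1.le σ hσ0 hz.2.le q)
  · have h2 := h.differentiableAt (hV.mem_nhds (show s ∈ _ from ⟨by linarith, hσs⟩))
    simp only [pnatPairEquiv.tsum_eq (zetaPolyTerm f _)] at h2
    exact h2.differentiableWithinAt
  · refine DifferentiableAt.differentiableWithinAt ?_
    simp only [zetaPolyTerm_pnatPairEquiv hf, rayDeriv]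
    refine DifferentiableAt.mul (DifferentiableAt.const_cpow (by fun_prop) (Or.inl ?_))
      (differentiable_cpowDeriv _ _ (eval_X_mul_pos hf (by positivity)) z)
    have : (q.1 : ℝ) + 1 ≠ 0 := by positivity
    exact_mod_cast this

lemma injective_fst_add (c : ℕ) :
    Function.Injective (fun q : ℕ × ℕ => (q.1, q.1 + q.2 + c)) := by
  rintro ⟨a, b⟩ ⟨c, d⟩ h
  simp only [Prod.mk.injEq] at h ⊢
  omega

lemma injective_add_fst (c : ℕ) :
    Function.Injective (fun q : ℕ × ℕ => (q.1 + q.2 + c, q.1)) := by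
  rintro ⟨a, b⟩ ⟨c, d⟩ h
  simp only [Prod.mk.injEq] at h ⊢
  omega

lemma tsum_prod_eq_add_tsum {u : ℕ × ℕ → ℂ} (hu : Summable u) :
    ∑' q, u q = ∑' q : ℕ × ℕ, u (q.1, q.1 + q.2) + ∑' q : ℕ × ℕ, u (q.1 + q.2 + 1, q.1) := by
  have hg : Function.Injective (fun q : ℕ × ℕ => (q.1, q.1 + q.2)) := injective_fst_add 0
  have hh : Function.Injective (fun q : ℕ × ℕ => (q.1 + q.2 + 1, q.1)) := injective_add_fst 1
  have hcompl : IsCompl (range fun q : ℕ × ℕ => (q.1, q.1 + q.2))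
      (range fun q : ℕ × ℕ => (q.1 + q.2 + 1, q.1)) := by
    rw [isCompl_iff, disjoint_iff_inter_eq_empty, codisjoint_iff_le_sup]
    constructor
    · ext ⟨a, b⟩
      simp only [mem_inter_iff, mem_range, Prod.mk.injEq, Prod.exists, mem_empty_iff_false,
        iff_false]
      rintro ⟨⟨x, y, h1, h2⟩, z, w, h3, h4⟩
      omega
    · rintro ⟨a, b⟩ -
      rcases le_or_gt a b with h | h
      · exact Or.inl ⟨(a, b - a), by simp only [Prod.mk.injEq, true_and]; omega⟩
      · exact Or.inr ⟨(b, a - b - 1), by simp only [Prod.mk.injEq, and_true]; omega⟩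
  refine (HasSum.add_isCompl hcompl ?_ ?_).tsum_eq
  · exact (Equiv.ofInjective _ hg).hasSum_iff.1 (hu.comp_injective hg).hasSum
  · exact (Equiv.ofInjective _ hh).hasSum_iff.1 (hu.comp_injective hh).hasSum

/-- Splitting a double series along the diagonal, the diagonal terms being shared equally between the
two halves. -/
lemma tsum_prod_eq_add_tsum_trapezoid {u : ℕ × ℕ → ℂ} (hu : Summable u) :
    ∑' q, u q = ∑' q : ℕ × ℕ, (u (q.1, q.1 + q.2) + u (q.1, q.1 + q.2 + 1)) / 2 +
      ∑' q : ℕ × ℕ, (u (q.1 + q.2, q.1) + u (q.1 + q.2 + 1, q.1)) / 2 := by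
  have hs : Summable (fun q : ℕ × ℕ => u q.swap) := (Equiv.prodComm ℕ ℕ).summable_iff.2 hu
  have h1 := tsum_prod_eq_add_tsum hu
  have h2 := tsum_prod_eq_add_tsum hs
  have h3 : ∑' q : ℕ × ℕ, u q.swap = ∑' q, u q := (Equiv.prodComm ℕ ℕ).tsum_eq u
  simp only [Prod.swap_prod_mk] at h2
  have i1 : Summable (fun q : ℕ × ℕ => u (q.1, q.1 + q.2)) :=
    hu.comp_injective (injective_fst_add 0)
  have i2 : Summable (fun q : ℕ × ℕ => u (q.1, q.1 + q.2 + 1)) :=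
    hu.comp_injective (injective_fst_add 1)
  have i3 : Summable (fun q : ℕ × ℕ => u (q.1 + q.2, q.1)) :=
    hu.comp_injective (injective_add_fst 0)
  have i4 : Summable (fun q : ℕ × ℕ => u (q.1 + q.2 + 1, q.1)) :=
    hu.comp_injective (injective_add_fst 1)
  rw [tsum_div_const, tsum_div_const, i1.tsum_add i2, i3.tsum_add i4]
  linear_combination (h1 + h2 - h3) / 2

/-- The part `n ≥ m` of the double series, with the diagonal terms counted with weight one half. With
`m = q.1 + 1` and `n = m + q.2`, it is the sum of the trapezoidal averages over the intervals
`[n, n + 1]`. -/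
noncomputable def halfSum (f : ℝ[X]) (s : ℂ) : ℂ :=
  ∑' q : ℕ × ℕ, (rayDeriv f 0 s ((q.1 : ℝ) + 1) ((q.1 : ℝ) + 1 + q.2) +
    rayDeriv f 0 s ((q.1 : ℝ) + 1) ((q.1 : ℝ) + 1 + q.2 + 1)) / 2

lemma summable_rayDeriv_zero {f : ℝ[X]} (hf : ∀ x : ℝ, 0 ≤ x → 0 < f.eval x) {s : ℂ}
    (hs : 2 / ((f.natDegree : ℝ) + 2) < s.re) :
    Summable (fun q : ℕ × ℕ => rayDeriv f 0 s ((q.1 : ℝ) + 1) ((q.2 : ℝ) + 1)) :=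
  (pnatPairEquiv.summable_iff.2 (summable_zetaPolyTerm hf hs)).congr
    (zetaPolyTerm_pnatPairEquiv hf s)

lemma tsum_zetaPolyTerm_eq_halfSum_add_halfSum {f : ℝ[X]} (hf : ∀ x : ℝ, 0 ≤ x → 0 < f.eval x)
    {s : ℂ} (hs : 2 / ((f.natDegree : ℝ) + 2) < s.re) :
    ∑' p, zetaPolyTerm f s p = halfSum f s + halfSum f.reverse s := by
  rw [← pnatPairEquiv.tsum_eq, tsum_congr (zetaPolyTerm_pnatPairEquiv hf s),
    tsum_prod_eq_add_tsum_trapezoid (summable_rayDeriv_zero hf hs), halfSum, halfSum]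
  have hrev : ∀ a b : ℕ, rayDeriv f.reverse 0 s ((a : ℝ) + 1) ((b : ℝ) + 1) =
      rayDeriv f 0 s ((b : ℝ) + 1) ((a : ℝ) + 1) := by
    intro a b
    have := rayDeriv_zero_reverse hf s b.succPNat a.succPNat
    simpa using this
  congr 1
  · refine tsum_congr fun q => ?_
    push_cast
    ring_nf
  · refine tsum_congr fun q => ?_
    rw [← hrev, ← hrev]
    push_cast
    ring_nf

end

/-! ### Summation of the Euler-Maclaurin formula over all rays -/

section

open Polynomial Set Filter Topology MeasureTheory

/-- The remainder of order `K` in the Euler-Maclaurin formula for the terms of the double series on the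
interval `[n, n + 1]`, with `m = q.1 + 1` and `n = m + q.2`. -/
noncomputable def emRemainder (f : ℝ[X]) (K : ℕ) (s : ℂ) (q : ℕ × ℕ) : ℂ :=
  ∫ x in (0 : ℝ)..1, ((bernoulliFun K x / K.factorial : ℝ) : ℂ) *
    rayDeriv f K s ((q.1 : ℝ) + 1) ((q.1 : ℝ) + 1 + q.2 + x)

lemma exists_norm_rayDeriv_le {f : ℝ[X]} (hf : ∀ x : ℝ, 0 ≤ x → 0 < f.eval x) (k : ℕ) (R : ℝ) :
    ∃ C : ℝ, 0 ≤ C ∧ ∀ s : ℂ, ‖s‖ ≤ R → ∀ m x : ℝ, 0 < m → m ≤ x →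
      ‖rayDeriv f k s m x‖ ≤ C * (m ^ (-s.re) * x ^ (-((f.natDegree + 1) * s.re + k))) := by
  obtain ⟨C, hC0, hC⟩ := exists_norm_cpowDeriv_le hf k R
  refine ⟨C, hC0, fun s hs m x hm hmx => ?_⟩
  have hx : 0 < x := hm.trans_le hmx
  have h := hC s hs (x / m) ((one_le_div hm).2 hmx)
  rw [rayDeriv, norm_mul, Complex.norm_cpow_eq_rpow_re_of_pos hm]
  -- the powers of `m` from the prefactor and from `x / m` combine to `m ^ (-Re s)`
  have hre : (-(((f.natDegree : ℂ) + 2) * s) - k).re =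
      -s.re + (-((f.natDegree + 1) * s.re) - k) := by
    simp; ring
  rw [hre]
  refine (mul_le_mul_of_nonneg_left h (by positivity)).trans (le_of_eq ?_)
  rw [Real.div_rpow hx.le hm.le, Real.rpow_add hm, neg_add']
  have : m ^ (-(((f.natDegree : ℝ) + 1) * s.re) - k) ≠ 0 := by positivity
  field_simp

/-- Since the remainder decays like `m ^ (-Re s) n ^ (-(d + 1) Re s - K)` and `n ≥ m`, part of the decay in
`n` may be moved to `m` so that both exponents become equal. -/
lemma exists_norm_emRemainder_le {f : ℝ[X]} (hf : ∀ x : ℝ, 0 ≤ x → 0 < f.eval x) (K : ℕ)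
    (R : ℝ) :
    ∃ C : ℝ, ∀ s : ℂ, ‖s‖ ≤ R → ∀ β : ℝ, 0 ≤ β → 2 * β ≤ (f.natDegree + 2) * s.re + K →
      ∀ q : ℕ × ℕ, ‖emRemainder f K s q‖ ≤ C * (((q.1 : ℝ) + 1) * ((q.2 : ℝ) + 1)) ^ (-β) := by
  obtain ⟨C, hC0, hC⟩ := exists_norm_rayDeriv_le hf K R
  obtain ⟨B, hB⟩ := isCompact_Icc.exists_bound_of_continuousOn (s := Icc (0 : ℝ) 1)
    (f := fun x => ((bernoulliFun K x / K.factorial : ℝ) : ℂ)) (by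
      have := continuous_bernoulliFun (k := K)
      fun_prop)
  refine ⟨|B| * C, fun s hs β hβ hβs q => ?_⟩
  set m : ℝ := (q.1 : ℝ) + 1 with hm
  have hm1 : 1 ≤ m := by rw [hm]; linarith [Nat.cast_nonneg (α := ℝ) q.1]
  have hj : (0 : ℝ) ≤ q.2 := Nat.cast_nonneg _
  have hd : (0 : ℝ) ≤ f.natDegree := Nat.cast_nonneg _
  have hK : (0 : ℝ) ≤ K := Nat.cast_nonneg _
  have hm0 : 0 < m := by linarith
  set e : ℝ := (f.natDegree + 1) * s.re + K with he
  have hγ : β ≤ (s.re + e) / 2 := by rw [he]; linarith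
  have hde : 0 ≤ (e - s.re) / 2 := by
    have : 0 ≤ f.natDegree * s.re + K := by
      rcases le_total 0 s.re with h | h
      · positivity
      · nlinarith
    rw [he]; linarith
  rw [emRemainder]
  have hbound : ∀ x ∈ uIoc (0 : ℝ) 1, ‖((bernoulliFun K x / K.factorial : ℝ) : ℂ) *
      rayDeriv f K s m (m + q.2 + x)‖ ≤ |B| * C * (m * ((q.2 : ℝ) + 1)) ^ (-β) := by
    intro x hx
    rw [uIoc_of_le zero_le_one] at hx
    have hn : m ≤ m + q.2 + x := by linarith [hx.1]
    have hn0 : 0 < m + q.2 + x := by linarith [hx.1]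
    have h1 := hC s hs m (m + q.2 + x) hm0 hn
    rw [norm_mul, mul_assoc]
    refine mul_le_mul ((hB x ⟨hx.1.le, hx.2⟩).trans (le_abs_self _)) (h1.trans ?_)
      (norm_nonneg _) (abs_nonneg _)
    refine mul_le_mul_of_nonneg_left ?_ hC0
    calc m ^ (-s.re) * (m + q.2 + x) ^ (-e)
        = m ^ (-s.re) * ((m + q.2 + x) ^ (-((s.re + e) / 2)) *
            (m + q.2 + x) ^ (-((e - s.re) / 2))) := by
          rw [← Real.rpow_add hn0]; ring_nf
      _ ≤ m ^ (-s.re) * ((m + q.2 + x) ^ (-((s.re + e) / 2)) * m ^ (-((e - s.re) / 2))) := by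
          -- here `n ≥ m` is used to trade decay in `n` for decay in `m`
          have h2 := Real.rpow_le_rpow_of_nonpos hm0 hn (neg_nonpos.2 hde)
          gcongr
      _ = (m * (m + q.2 + x)) ^ (-((s.re + e) / 2)) := by
          rw [Real.mul_rpow hm0.le hn0.le, mul_left_comm, ← Real.rpow_add hm0]
          ring_nf
      _ ≤ (m * ((q.2 : ℝ) + 1)) ^ (-((s.re + e) / 2)) := by
          refine Real.rpow_le_rpow_of_nonpos (by positivity) ?_ (by linarith)
          exact mul_le_mul_of_nonneg_left (by linarith [hx.1]) hm0.le
      _ ≤ _ := by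
          refine Real.rpow_le_rpow_of_exponent_le ?_ (by linarith)
          exact one_le_mul_of_one_le_of_one_le hm1 (by linarith)
  have := intervalIntegral.norm_integral_le_of_norm_le_const hbound
  simpa using this

lemma summable_emRemainder {f : ℝ[X]} (hf : ∀ x : ℝ, 0 ≤ x → 0 < f.eval x) (K : ℕ) {s : ℂ}
    (hs : 2 < (f.natDegree + 2) * s.re + K) : Summable (emRemainder f K s) := by
  obtain ⟨C, hC⟩ := exists_norm_emRemainder_le hf K ‖s‖
  refine Summable.of_norm_bounded ((summable_prod_rpow
    (by linarith : 1 < ((f.natDegree + 2) * s.re + K) / 2)).mul_left C) fun q => ?_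
  exact hC s le_rfl _ (by linarith) (by linarith) q

lemma differentiable_emRemainder {f : ℝ[X]} (hf : ∀ x : ℝ, 0 ≤ x → 0 < f.eval x) (K : ℕ)
    (q : ℕ × ℕ) : Differentiable ℂ (fun s => emRemainder f K s q) := by
  have hm : (0 : ℝ) < (q.1 : ℝ) + 1 := by positivity
  have hne : (((q.1 : ℝ) + 1 : ℝ) : ℂ) ≠ 0 := by exact_mod_cast hm.ne'
  have hp : ∀ x ∈ Icc (0 : ℝ) 1,
      0 < (X * f).eval (((q.1 : ℝ) + 1 + q.2 + x) / ((q.1 : ℝ) + 1)) := fun x hx =>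
    eval_X_mul_pos hf (by have := hx.1; positivity)
  rw [← differentiableOn_univ]
  refine differentiableOn_intervalIntegral_of_continuousOn isOpen_univ ?_ ?_
  · rintro ⟨s, x⟩ ⟨-, hx⟩
    refine ContinuousAt.continuousWithinAt (ContinuousAt.mul ?_ (ContinuousAt.mul ?_ ?_))
    · have := continuous_bernoulliFun (k := K)
      fun_prop
    · exact ContinuousAt.const_cpow (by fun_prop) (Or.inl hne)
    · exact (continuousAt_cpowDeriv (X * f) K s (hp x hx)).comp
        (f := fun q' : ℂ × ℝ => (q'.1, ((q.1 : ℝ) + 1 + q.2 + q'.2) / ((q.1 : ℝ) + 1)))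
        (x := (s, x)) (by fun_prop)
  · intro x hx s _
    refine DifferentiableAt.differentiableWithinAt (DifferentiableAt.const_mul
      (DifferentiableAt.mul ?_ ?_) _)
    · exact DifferentiableAt.const_cpow (by fun_prop) (Or.inl hne)
    · exact differentiable_cpowDeriv _ _ (hp x hx) s

lemma differentiableOn_tsum_emRemainder {f : ℝ[X]} (hf : ∀ x : ℝ, 0 ≤ x → 0 < f.eval x) (K : ℕ) :
    DifferentiableOn ℂ (fun s => ∑' q, emRemainder f K s q)
      {s | 2 < (f.natDegree + 2) * s.re + K} := by
  intro s hs
  have hs' : 2 < (f.natDegree + 2) * s.re + K := hs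
  obtain ⟨β, hβ, hβs⟩ := exists_between
    (by linarith : 1 < ((f.natDegree + 2) * s.re + K) / 2)
  obtain ⟨C, hC⟩ := exists_norm_emRemainder_le hf K (‖s‖ + 1)
  have hV : IsOpen {z : ℂ | ‖z‖ < ‖s‖ + 1 ∧ 2 * β < (f.natDegree + 2) * z.re + K} :=
    (isOpen_lt continuous_norm continuous_const).inter
      (isOpen_lt (f := fun _ : ℂ => 2 * β) (g := fun z : ℂ => (f.natDegree + 2) * z.re + K)
        continuous_const (by fun_prop))
  have h := Complex.differentiableOn_tsum_of_summable_norm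
    (F := fun (q : ℕ × ℕ) z => emRemainder f K z q) ((summable_prod_rpow hβ).mul_left C)
    (fun q => (differentiable_emRemainder hf K q).differentiableOn) hV
    (fun q z hz => hC z hz.1.le β (by linarith) hz.2.le q)
  exact (h.differentiableAt (hV.mem_nhds ⟨by linarith, by linarith⟩)).differentiableWithinAt

lemma emRemainder_neg_nat_eq_zero {f : ℝ[X]} (hf : ∀ x : ℝ, 0 ≤ x → 0 < f.eval x) {N K : ℕ}
    (hK : N * (f.natDegree + 1) < K) (q : ℕ × ℕ) : emRemainder f K (-N) q = 0 := by
  simp only [emRemainder, rayDeriv]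
  have h : ∀ t, cpowDeriv (X * f) K (-N) t = 0 := fun t =>
    cpowDeriv_neg_nat_eq_zero (mul_ne_zero X_ne_zero (ne_zero_of_eval_pos hf))
      (by rwa [natDegree_X_mul_of_pos hf]) t
  simp [h]

lemma hasSum_riemannZeta {z : ℂ} (hz : 1 < z.re) :
    HasSum (fun a : ℕ => (((a : ℝ) + 1 : ℝ) : ℂ) ^ (-z)) (riemannZeta z) := by
  have h1 : Summable (fun a : ℕ => 1 / ((a : ℂ) + 1) ^ z) := by
    have := (summable_nat_add_iff 1).2 (Complex.summable_one_div_nat_cpow.2 hz)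
    simpa using this
  rw [zeta_eq_tsum_one_div_nat_add_one_cpow hz]
  convert h1.hasSum using 2 with a
  rw [Complex.cpow_neg, one_div]
  push_cast
  rfl

/-- The right-hand side of the Euler-Maclaurin formula summed over all rays, which continues `halfSum`
to the half-plane `2 < (d + 2) Re s + M + 1`. The integral
`∫_1^∞ (t f(t)) ^ (-s) dt` enters through its meromorphic continuation `tailCont`. -/
noncomputable def halfCont (f : ℝ[X]) (M : ℕ) (s : ℂ) : ℂ :=
  tailCont f (M + 1) s * riemannZeta ((f.natDegree + 2) * s - 1) -
    ∑ k ∈ Finset.range M, (-1) ^ k * ((_root_.bernoulli (k + 2) / (k + 2).factorial : ℝ) : ℂ) *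
      cpowDeriv (X * f) (k + 1) s 1 * riemannZeta ((f.natDegree + 2) * s + (k + 1 : ℕ)) +
    (-1) ^ M * ∑' q, emRemainder f (M + 1) s q

lemma tendsto_rayDeriv {f : ℝ[X]} (hf : ∀ x : ℝ, 0 ≤ x → 0 < f.eval x) (k : ℕ) {s : ℂ}
    (hs : 0 < s.re) {m : ℝ} (hm : 0 < m) :
    Tendsto (rayDeriv f k s m) atTop (𝓝 0) := by
  obtain ⟨C, -, hC⟩ := exists_norm_rayDeriv_le hf k ‖s‖
  have he : 0 < ((f.natDegree : ℝ) + 1) * s.re + k := by positivity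
  refine squeeze_zero_norm' ((eventually_ge_atTop m).mono fun x hx => hC s le_rfl m x hm hx) ?_
  simpa using ((tendsto_rpow_neg_atTop he).const_mul (m ^ (-s.re))).const_mul C

/-- The main terms are differences of the primitive `tailPrimitive`, so they telescope along a ray just
like the boundary terms. -/
lemma integral_rayDeriv_zero {f : ℝ[X]} (hf : ∀ x : ℝ, 0 ≤ x → 0 < f.eval x) {s : ℂ}
    (hs : 0 < (((f.natDegree : ℂ) + 1) * s - 2).re) {m y : ℝ} (hm : 0 < m) (hy : 0 < y) :
    ∫ x in (0 : ℝ)..1, rayDeriv f 0 s m (y + x) =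
      (m : ℂ) ^ (-((f.natDegree + 2) * s - 1)) *
        (tailPrimitive f s (y / m) - tailPrimitive f s ((y + 1) / m)) := by
  have hne : (m : ℂ) ≠ 0 := by exact_mod_cast hm.ne'
  have hd : ∀ x ∈ uIcc (0 : ℝ) 1, HasDerivAt (fun x => -((m : ℂ) ^ (-((f.natDegree + 2) * s - 1)) *
      tailPrimitive f s ((y + x) / m))) (rayDeriv f 0 s m (y + x)) x := by
    intro x hx
    rw [uIcc_of_le zero_le_one] at hx
    have h := (hasDerivAt_tailPrimitive hf hs (t := (y + x) / m)
      (by have := hx.1; positivity)).scomp x (((hasDerivAt_id x).const_add y).div_const m)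
    refine (h.const_mul ((m : ℂ) ^ (-((f.natDegree + 2) * s - 1)))).neg.congr_deriv ?_
    have e : -(((f.natDegree : ℂ) + 2) * s - 1) = -((f.natDegree + 2) * s) - (0 : ℕ) + 1 := by
      push_cast; ring
    rw [rayDeriv, e, Complex.cpow_add _ 1 hne, Complex.cpow_one, Complex.real_smul]
    push_cast
    field_simp
  rw [intervalIntegral.integral_eq_sub_of_hasDerivAt hd]
  · rw [add_zero]; ring
  · refine ContinuousOn.intervalIntegrable_of_Icc zero_le_one fun x hx => ?_
    have hyx : 0 < y + x := by linarith [hx.1]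
    exact ContinuousAt.continuousWithinAt ((hasDerivAt_rayDeriv hf 0 s hm hyx).continuousAt.comp
      (f := fun x => y + x) (by fun_prop))

/-- For each fixed `m`, the Euler-Maclaurin formula on the intervals `[m + j, m + j + 1]` telescopes in
`j`; what remains at `j = 0` is a combination of powers of `m`, and summing over `m` produces values
of the Riemann zeta function. -/
lemma halfSum_eq_halfCont {f : ℝ[X]} (hf : ∀ x : ℝ, 0 ≤ x → 0 < f.eval x) (M : ℕ) {s : ℂ}
    (hs : 2 < s.re) : halfSum f s = halfCont f M s := by
  have hd : (0 : ℝ) ≤ f.natDegree := Nat.cast_nonneg _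
  have hs0 : 0 < s.re := by linarith
  have hds : 0 ≤ f.natDegree * s.re := by positivity
  have hconv : 2 / ((f.natDegree : ℝ) + 2) < s.re := by
    rw [div_lt_iff₀ (by positivity)]; nlinarith
  have htail : 0 < (((f.natDegree : ℂ) + 1) * s - 2).re := by
    simp; linarith
  have hrem : 2 < ((f.natDegree : ℝ) + 2) * s.re + (M + 1 : ℕ) := by
    push_cast; nlinarith [Nat.cast_nonneg (α := ℝ) M]
  set u : ℕ × ℕ → ℂ := fun q => rayDeriv f 0 s ((q.1 : ℝ) + 1) ((q.2 : ℝ) + 1) with hu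
  have hus : Summable u := summable_rayDeriv_zero hf hconv
  have hb : Summable (fun q : ℕ × ℕ => (rayDeriv f 0 s ((q.1 : ℝ) + 1) ((q.1 : ℝ) + 1 + q.2) +
      rayDeriv f 0 s ((q.1 : ℝ) + 1) ((q.1 : ℝ) + 1 + q.2 + 1)) / 2) := by
    have i1 : Summable (fun q : ℕ × ℕ => u (q.1, q.1 + q.2)) :=
      hus.comp_injective (injective_fst_add 0)
    have i2 : Summable (fun q : ℕ × ℕ => u (q.1, q.1 + q.2 + 1)) :=
      hus.comp_injective (injective_fst_add 1)
    refine ((i1.add i2).div_const 2).congr fun q => ?_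
    simp only [hu]
    push_cast
    ring_nf
  have hr := summable_emRemainder hf (M + 1) hrem
  set β : ℕ → ℂ := fun k => (-1) ^ k * ((_root_.bernoulli (k + 2) / (k + 2).factorial : ℝ) : ℂ) with hβ
  -- the sum over the ray of fixed `m = a + 1`
  have hray : ∀ a : ℕ, ∑' j : ℕ, (rayDeriv f 0 s ((a : ℝ) + 1) ((a : ℝ) + 1 + j) +
      rayDeriv f 0 s ((a : ℝ) + 1) ((a : ℝ) + 1 + j + 1)) / 2 =
      (((a : ℝ) + 1 : ℝ) : ℂ) ^ (-((f.natDegree + 2) * s - 1)) * tailIntegral f 0 s -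
        ∑ k ∈ Finset.range M, β k * cpowDeriv (X * f) (k + 1) s 1 *
          (((a : ℝ) + 1 : ℝ) : ℂ) ^ (-((f.natDegree + 2) * s + (k + 1 : ℕ))) +
        (-1) ^ M * ∑' j, emRemainder f (M + 1) s (a, j) := by
    intro a
    set m : ℝ := (a : ℝ) + 1 with hm
    have hm0 : 0 < m := by positivity
    have h := tsum_eq_of_telescoping (ε := (-1) ^ M)
      (a := fun j : ℕ => (m : ℂ) ^ (-((f.natDegree + 2) * s - 1)) *
        tailPrimitive f s ((m + j) / m) -
        ∑ k ∈ Finset.range M, β k * rayDeriv f (k + 1) s m (m + j))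
      (hb.prod_factor a) (hr.prod_factor a) ?_ ?_
    · rw [h]
      simp only [Nat.cast_zero, add_zero, div_self hm0.ne', tailPrimitive_one, rayDeriv]
      congr 2
      refine Finset.sum_congr rfl fun k _ => ?_
      rw [neg_add']
      ring
    · have hto : Tendsto (fun j : ℕ => m + (j : ℝ)) atTop atTop :=
        tendsto_atTop_add_const_left _ _ tendsto_natCast_atTop_atTop
      have t1 := ((tendsto_tailPrimitive hf htail).comp (hto.atTop_div_const hm0)).const_mul
        ((m : ℂ) ^ (-((f.natDegree + 2) * s - 1)))
      have t2 : Tendsto (fun j : ℕ => ∑ k ∈ Finset.range M, β k * rayDeriv f (k + 1) s m (m + j))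
          atTop (𝓝 (∑ k ∈ Finset.range M, β k * 0)) :=
        tendsto_finsetSum _ fun k _ =>
          ((tendsto_rayDeriv hf (k + 1) hs0 hm0).comp hto).const_mul _
      simpa using t1.sub t2
    · intro j
      have hmj : 0 < m + j := by positivity
      have h := trapezoid_eq_integral_add_sum (fun k x => rayDeriv f k s m (m + j + x))
        (fun k x hx => by
          have hx0 : 0 < m + j + x := by linarith [hx.1]
          simpa using (hasDerivAt_rayDeriv hf k s hm0 hx0).comp_const_add (m + j) x) M
      simp only [add_zero] at h
      rw [h, integral_rayDeriv_zero hf htail hm0 hmj, emRemainder]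
      simp only [← hm]
      simp only [Nat.cast_add_one, ← add_assoc, mul_sub, Finset.sum_sub_distrib, hβ]
      ring
  have hz1 := (hasSum_riemannZeta (z := (f.natDegree + 2) * s - 1) (by simp; linarith)).mul_right
    (tailIntegral f 0 s)
  have hz2 : HasSum (fun a : ℕ => ∑ k ∈ Finset.range M, β k * cpowDeriv (X * f) (k + 1) s 1 *
      (((a : ℝ) + 1 : ℝ) : ℂ) ^ (-((f.natDegree + 2) * s + (k + 1 : ℕ))))
      (∑ k ∈ Finset.range M, β k * cpowDeriv (X * f) (k + 1) s 1 *
        riemannZeta ((f.natDegree + 2) * s + (k + 1 : ℕ))) :=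
    hasSum_sum fun k _ => (hasSum_riemannZeta (by
      simp; nlinarith [Nat.cast_nonneg (α := ℝ) k])).mul_left _
  have hz3 : HasSum (fun a => (-1) ^ M * ∑' j, emRemainder f (M + 1) s (a, j))
      ((-1) ^ M * ∑' q, emRemainder f (M + 1) s q) := by
    rw [hr.tsum_prod]
    exact hr.prod.hasSum.mul_left _
  rw [halfSum, hb.tsum_prod, tsum_congr hray, ((hz1.sub hz2).add hz3).tsum_eq, halfCont,
    ← tailIntegral_zero_eq_tailCont hf (M + 1) htail]
  ring

end

/-! ### Meromorphy of the continuation and its limit at negative odd integers -/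

section

open Polynomial Set Filter Topology MeasureTheory

lemma meromorphicAt_riemannZeta (z : ℂ) : MeromorphicAt riemannZeta z := by
  have hd : ∀ w : ℂ, w ≠ 1 → AnalyticAt ℂ riemannZeta w := fun w hw =>
    DifferentiableOn.analyticAt (s := {1}ᶜ)
      (fun v hv => (differentiableAt_riemannZeta hv).differentiableWithinAt)
      (isOpen_compl_singleton.mem_nhds hw)
  rcases eq_or_ne z 1 with rfl | hz
  · set g : ℂ → ℂ := Function.update (fun s => (s - 1) * riemannZeta s) 1 1 with hg
    have hgne : ∀ w : ℂ, w ≠ 1 → g w = (w - 1) * riemannZeta w := fun w hw => by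
      rw [hg, Function.update_of_ne hw]
    have hga : AnalyticAt ℂ g 1 := by
      refine Complex.analyticAt_of_differentiable_on_punctured_nhds_of_continuousAt ?_ ?_
      · filter_upwards [self_mem_nhdsWithin] with w hw
        have h1 : (fun s => (s - 1) * riemannZeta s) =ᶠ[𝓝 w] g := by
          filter_upwards [isOpen_compl_singleton.mem_nhds hw] with v hv using (hgne v hv).symm
        refine DifferentiableAt.congr_of_eventuallyEq ?_ h1.symm
        exact DifferentiableAt.mul (by fun_prop) (differentiableAt_riemannZeta hw)
      · rw [hg, continuousAt_update_same]
        exact riemannZeta_residue_one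
    have hm : MeromorphicAt (fun s => g s / (s - 1)) 1 :=
      hga.meromorphicAt.div (by fun_prop)
    refine hm.congr ?_
    filter_upwards [self_mem_nhdsWithin] with w hw
    rw [hgne w hw, mul_div_cancel_left₀ _ (sub_ne_zero.2 hw)]
  · exact (hd z hz).meromorphicAt

lemma meromorphicAt_riemannZeta_affine (a b z : ℂ) :
    MeromorphicAt (fun s => riemannZeta (a * s + b)) z :=
  (meromorphicAt_riemannZeta (a * z + b)).comp_analyticAt (g := fun s => a * s + b) (by fun_prop)

lemma analyticAt_cpowDeriv (p : ℝ[X]) (k : ℕ) {t : ℝ} (ht : 0 < p.eval t) (z : ℂ) :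
    AnalyticAt ℂ (fun s => cpowDeriv p k s t) z :=
  (differentiable_cpowDeriv p k ht).analyticAt z

lemma analyticAt_tailIntegral {f : ℝ[X]} (hf : ∀ x : ℝ, 0 ≤ x → 0 < f.eval x) (k : ℕ) {s : ℂ}
    (hs : 0 < (((f.natDegree : ℂ) + 1) * s - 2 + k).re) : AnalyticAt ℂ (tailIntegral f k) s :=
  (differentiableOn_tailIntegral hf k).analyticAt
    ((isOpen_lt continuous_const (by fun_prop)).mem_nhds hs)

lemma re_tail_pos (f : ℝ[X]) {M : ℕ} (hM : 1 ≤ M) {s : ℂ}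
    (hs : 2 < ((f.natDegree : ℝ) + 2) * s.re + (M + 1 : ℕ)) :
    0 < (((f.natDegree : ℂ) + 1) * s - 2 + (M + 1 : ℕ)).re := by
  have hM' : (1 : ℝ) ≤ M := by exact_mod_cast hM
  have hd : (0 : ℝ) ≤ f.natDegree := Nat.cast_nonneg _
  have e : (((f.natDegree : ℂ) + 1) * s - 2 + (M + 1 : ℕ)).re =
      (f.natDegree + 1) * s.re - 2 + (M + 1) := by simp
  push_cast at hs
  rw [e]
  rcases lt_trichotomy s.re 0 with h | h | h
  · linarith
  · rw [h] at hs ⊢; linarith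
  · nlinarith [mul_pos (by linarith : 0 < (f.natDegree : ℝ) + 1) h]

lemma analyticAt_tsum_emRemainder {f : ℝ[X]} (hf : ∀ x : ℝ, 0 ≤ x → 0 < f.eval x) {K : ℕ} {s : ℂ}
    (hs : 2 < ((f.natDegree : ℝ) + 2) * s.re + K) :
    AnalyticAt ℂ (fun s => ∑' q, emRemainder f K s q) s :=
  (differentiableOn_tsum_emRemainder hf K).analyticAt
    ((isOpen_lt (f := fun _ : ℂ => (2 : ℝ)) (g := fun z : ℂ => (f.natDegree + 2) * z.re + K)
        continuous_const (by fun_prop)).mem_nhds hs)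

lemma meromorphicAt_halfCont {f : ℝ[X]} (hf : ∀ x : ℝ, 0 ≤ x → 0 < f.eval x) {M : ℕ} (hM : 1 ≤ M)
    {s : ℂ} (hs : 2 < ((f.natDegree : ℝ) + 2) * s.re + (M + 1 : ℕ)) :
    MeromorphicAt (halfCont f M) s := by
  have hprod : ∀ k : ℕ, MeromorphicAt (fun s : ℂ =>
      ∏ i ∈ Finset.range k, (((f.natDegree : ℂ) + 1) * s - 1 + i)) s := fun k =>
    AnalyticAt.meromorphicAt (by fun_prop)
  have h1 : MeromorphicAt (tailCont f (M + 1)) s := by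
    refine MeromorphicAt.fun_add (MeromorphicAt.fun_sum fun k _ => ?_) ?_
    · exact ((MeromorphicAt.const _ _).fun_mul (analyticAt_cpowDeriv _ k
        (eval_reverse_pos hf 1 zero_le_one) s).meromorphicAt).fun_div (hprod _)
    · exact ((MeromorphicAt.const _ _).fun_mul
        (analyticAt_tailIntegral hf _ (re_tail_pos f hM hs)).meromorphicAt).fun_div (hprod _)
  have h2 := analyticAt_tsum_emRemainder hf hs
  refine MeromorphicAt.fun_add (MeromorphicAt.fun_sub (h1.fun_mul ?_)
    (MeromorphicAt.fun_sum fun k _ => MeromorphicAt.fun_mul (MeromorphicAt.fun_mul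
      (MeromorphicAt.const _ _) (analyticAt_cpowDeriv _ _
        (eval_X_mul_pos hf one_pos) s).meromorphicAt) (meromorphicAt_riemannZeta_affine _ _ _))) ?_
  · simpa only [sub_eq_add_neg] using meromorphicAt_riemannZeta_affine _ (-1) s
  · exact (MeromorphicAt.const _ _).fun_mul h2.meromorphicAt

lemma riemannZeta_neg_even {e : ℕ} (he : Even e) (h0 : e ≠ 0) : riemannZeta (-(e : ℂ)) = 0 := by
  obtain ⟨r, rfl⟩ := he
  obtain ⟨n, rfl⟩ := Nat.exists_eq_succ_of_ne_zero (n := r) (by omega)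
  rw [← riemannZeta_neg_two_mul_nat_add_one n]
  congr 1
  push_cast
  ring

/-- The only factor of the product that vanishes at `s = -N` is the one with `i = (d + 1) N + 1`, and it
has a simple zero. If it occurs, it is compensated by the zero of `a`, so the zero of `b` survives. -/
lemma tendsto_div_prod_mul {d N k : ℕ} {a b : ℂ → ℂ} (ha : DifferentiableAt ℂ a (-N))
    (hb : ContinuousAt b (-N)) (hb0 : b (-N) = 0) (hk : (d + 1) * N + 1 < k → a (-N) = 0) :
    Tendsto (fun s => a s / (∏ i ∈ Finset.range k, (((d : ℂ) + 1) * s - 1 + i)) * b s)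
      (𝓝[≠] (-N : ℂ)) (𝓝 0) := by
  set k₀ := (d + 1) * N + 1 with hk₀
  have hval : ∀ i : ℕ, ((d : ℂ) + 1) * (-N) - 1 + i = (i : ℂ) - k₀ := fun i => by
    rw [hk₀]; push_cast; ring
  have hb' : Tendsto b (𝓝[≠] (-N : ℂ)) (𝓝 0) := by
    rw [← hb0]; exact hb.tendsto.mono_left nhdsWithin_le_nhds
  by_cases h : k₀ < k
  · have hfac : ∀ s : ℂ, ∏ i ∈ Finset.range k, (((d : ℂ) + 1) * s - 1 + i) =
        (((d : ℂ) + 1) * (s - -N)) *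
          ∏ i ∈ (Finset.range k).erase k₀, (((d : ℂ) + 1) * s - 1 + i) := fun s => by
      rw [← Finset.mul_prod_erase _ _ (Finset.mem_range.2 h)]
      congr 1
      rw [hk₀]; push_cast; ring
    have hP : ContinuousAt (fun s : ℂ => ∏ i ∈ (Finset.range k).erase k₀,
        (((d : ℂ) + 1) * s - 1 + i)) (-N) := by fun_prop
    have hP0 : ∏ i ∈ (Finset.range k).erase k₀, (((d : ℂ) + 1) * (-N : ℂ) - 1 + i) ≠ 0 := by
      refine Finset.prod_ne_zero_iff.2 fun i hi => ?_
      rw [hval, sub_ne_zero]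
      exact_mod_cast (Finset.mem_erase.1 hi).1
    have hslope := hasDerivAt_iff_tendsto_slope.1 ha.hasDerivAt
    have hlim := ((hslope.div ((hP.tendsto.mono_left nhdsWithin_le_nhds).const_mul ((d : ℂ) + 1))
      (mul_ne_zero (by exact_mod_cast Nat.succ_ne_zero d) hP0)).mul hb')
    rw [mul_zero] at hlim
    refine hlim.congr fun s => ?_
    rw [hfac s, Pi.div_apply, slope_def_field, hk h, sub_zero, div_div]
    congr 2
    ring
  · have hP : ContinuousAt (fun s : ℂ => ∏ i ∈ Finset.range k, (((d : ℂ) + 1) * s - 1 + i))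
        (-N) := by fun_prop
    have hP0 : ∏ i ∈ Finset.range k, (((d : ℂ) + 1) * (-N : ℂ) - 1 + i) ≠ 0 := by
      refine Finset.prod_ne_zero_iff.2 fun i hi => ?_
      rw [hval, sub_ne_zero]
      have := Finset.mem_range.1 hi
      exact_mod_cast (by omega : i ≠ k₀)
    have := ((ha.continuousAt.div hP hP0).tendsto.mono_left
      (nhdsWithin_le_nhds (s := {(-N : ℂ)}ᶜ))).mul hb'
    rwa [mul_zero] at this

/-- The possible simple pole of the continued integral at `s = -N` does not occur: its residue is a
multiple of a derivative of the polynomial `φ ^ N` of order exceeding the degree. Hence the zero of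
`b` is not cancelled. -/
lemma tendsto_tailCont_mul {f : ℝ[X]} (hf : ∀ x : ℝ, 0 ≤ x → 0 < f.eval x) {N K : ℕ} {b : ℂ → ℂ}
    (hK : (f.natDegree + 1) * N + 2 < K) (hb : ContinuousAt b (-N)) (hb0 : b (-N) = 0) :
    Tendsto (fun s => tailCont f K s * b s) (𝓝[≠] (-N : ℂ)) (𝓝 0) := by
  have hzero : ∀ k, (f.natDegree + 1) * N < k → ∀ t, cpowDeriv f.reverse k (-N) t = 0 :=
    fun k hk t => by
      refine cpowDeriv_neg_nat_eq_zero (ne_zero_of_eval_pos (eval_reverse_pos hf)) ?_ t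
      rw [natDegree_reverse_eq hf]
      nlinarith
  have hre : 0 < (((f.natDegree : ℂ) + 1) * (-N) - 2 + K).re := by
    have e : (((f.natDegree : ℂ) + 1) * (-N) - 2 + K).re =
        (K : ℝ) - ((f.natDegree + 1) * N + 2 : ℕ) := by
      simp; ring
    rw [e, sub_pos]
    exact_mod_cast hK
  have hexp : ∀ s, tailCont f K s * b s =
      ∑ k ∈ Finset.range K, (-1) ^ k * cpowDeriv f.reverse k s 1 /
        (∏ i ∈ Finset.range (k + 1), (((f.natDegree : ℂ) + 1) * s - 1 + i)) * b s +
      (-1) ^ K * tailIntegral f K s /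
        (∏ i ∈ Finset.range K, (((f.natDegree : ℂ) + 1) * s - 1 + i)) * b s := fun s => by
    rw [tailCont, add_mul _ _ (b s), Finset.sum_mul]
  simp only [hexp]
  rw [show (0 : ℂ) = ∑ k ∈ Finset.range K, 0 + 0 by simp]
  refine Tendsto.add (tendsto_finsetSum _ fun k _ => ?_) ?_
  · refine tendsto_div_prod_mul (d := f.natDegree) (k := k + 1) (a := fun s => (-1) ^ k * cpowDeriv f.reverse k s 1)
      ?_ hb hb0 fun hk => ?_
    · exact (differentiable_cpowDeriv _ k (eval_reverse_pos hf 1 zero_le_one) _).const_mul _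
    · rw [hzero k (by omega), mul_zero]
  · refine tendsto_div_prod_mul (d := f.natDegree) (k := K) (a := fun s => (-1) ^ K * tailIntegral f K s)
      ?_ hb hb0 fun hk => ?_
    · exact (analyticAt_tailIntegral hf K hre).differentiableAt.const_mul _
    · simp [tailIntegral, hzero K (by omega)]

/-- For odd `N` every summand of `halfCont` tends to `0` at `s = -N`. As `(d + 2) N` is odd, the zeta values
multiplying the integral and the nonzero Bernoulli numbers are taken at even integers. At negative
ones they are trivial zeros; at the others the order of differentiation exceeds the degree of
`(X f) ^ N`, so the coefficient vanishes, as does the remainder. -/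
lemma tendsto_halfCont {f : ℝ[X]} (hf : ∀ x : ℝ, 0 ≤ x → 0 < f.eval x) (hd : Odd f.natDegree)
    {N M : ℕ} (hN : Odd N) (hM : (f.natDegree + 2) * N + 2 ≤ M) :
    Tendsto (halfCont f M) (𝓝[≠] (-N : ℂ)) (𝓝 0) := by
  have hN1 : 1 ≤ N := hN.pos
  have hodd : Odd ((f.natDegree + 2) * N) := (hd.add_even even_two).mul hN
  have hre : 2 < ((f.natDegree : ℝ) + 2) * (-N : ℂ).re + (M + 1 : ℕ) := by
    have : (((f.natDegree + 2) * N + 2 : ℕ) : ℝ) ≤ M := by exact_mod_cast hM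
    push_cast at this ⊢
    simp only [Complex.neg_re, Complex.natCast_re]
    linarith
  have hζ : ∀ z : ℂ, z ≠ 1 → ∀ c : ℂ, ((f.natDegree : ℂ) + 2) * (-N) + c = z →
      ContinuousAt (fun s => riemannZeta ((f.natDegree + 2) * s + c)) (-N) := by
    intro z hz c hc
    refine ContinuousAt.comp (g := riemannZeta) (f := fun s => ((f.natDegree : ℂ) + 2) * s + c)
      ?_ (by fun_prop)
    rw [hc]
    exact (differentiableAt_riemannZeta hz).continuousAt
  have hne1 : ∀ e : ℤ, e ≠ 1 → (e : ℂ) ≠ 1 := fun e he => by exact_mod_cast he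
  rw [show (0 : ℂ) = 0 - ∑ k ∈ Finset.range M, 0 + (-1) ^ M * 0 by simp]
  refine Tendsto.add (Tendsto.sub ?_ (tendsto_finsetSum _ fun k _ => ?_)) ?_
  · have e1 : ((f.natDegree : ℂ) + 2) * (-N) + -1 = -(((f.natDegree + 2) * N + 1 : ℕ) : ℂ) := by
      push_cast; ring
    have h0 := riemannZeta_neg_even hodd.add_one (by omega)
    simp only [sub_eq_add_neg _ (1 : ℂ)]
    refine tendsto_tailCont_mul hf (by nlinarith) (hζ _ ?_ _ e1) (by rw [e1]; exact h0)
    have := hne1 (-((f.natDegree + 2) * N + 1 : ℕ)) (by omega)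
    exact_mod_cast this
  -- the Bernoulli number `B_(k+2)` vanishes for odd `k`; for even `k` the argument of zeta is even
  · by_cases hk : Odd k
    · have hB : _root_.bernoulli (k + 2) = 0 :=
        bernoulli_eq_zero_of_odd (hk.add_even even_two) (by omega)
      simp [hB]
    · have hk' : Odd (k + 1) := (Nat.not_odd_iff_even.1 hk).add_one
      have e1 : ((f.natDegree : ℂ) + 2) * (-N) + (k + 1 : ℕ) =
          (((k + 1 : ℕ) - ((f.natDegree + 2) * N : ℕ) : ℤ) : ℂ) := by
        push_cast; ring
      have hpar : Even (((k + 1 : ℕ) : ℤ) - ((f.natDegree + 2) * N : ℕ)) := by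
        refine Odd.sub_odd ?_ ?_ <;> exact_mod_cast (by assumption)
      have hcont := hζ _ (hne1 _ (by
        intro h; rw [h] at hpar; exact absurd hpar (by decide))) _ e1
      have hc2 := ((differentiable_cpowDeriv (X * f) (k + 1) (eval_X_mul_pos hf one_pos)
        (-N)).continuousAt.const_mul ((-1) ^ k *
          ((_root_.bernoulli (k + 2) / (k + 2).factorial : ℝ) : ℂ))).mul hcont
      have hlim : Tendsto (fun s : ℂ => (-1) ^ k *
          ((_root_.bernoulli (k + 2) / (k + 2).factorial : ℝ) : ℂ) * cpowDeriv (X * f) (k + 1) s 1 *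
            riemannZeta ((f.natDegree + 2) * s + (k + 1 : ℕ))) (𝓝[≠] (-N : ℂ))
          (𝓝 ((-1) ^ k * ((_root_.bernoulli (k + 2) / (k + 2).factorial : ℝ) : ℂ) *
            cpowDeriv (X * f) (k + 1) (-N) 1 *
              riemannZeta ((f.natDegree + 2) * (-N) + (k + 1 : ℕ)))) :=
        hc2.tendsto.mono_left (nhdsWithin_le_nhds (s := {(-N : ℂ)}ᶜ))
      rcases lt_or_ge (k + 1) ((f.natDegree + 2) * N) with h | h
      · have hz : riemannZeta (((f.natDegree : ℂ) + 2) * (-N) + (k + 1 : ℕ)) = 0 := by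
          have := riemannZeta_neg_even (e := (f.natDegree + 2) * N - (k + 1))
            (Nat.Odd.sub_odd hodd hk') (by omega)
          rw [← this, Nat.cast_sub h.le]
          congr 1
          push_cast; ring
        rwa [hz, mul_zero] at hlim
      · have hz : cpowDeriv (X * f) (k + 1) (-N) 1 = 0 :=
          cpowDeriv_neg_nat_eq_zero (mul_ne_zero X_ne_zero (ne_zero_of_eval_pos hf))
            (by rw [natDegree_X_mul_of_pos hf]; nlinarith) 1
        rwa [hz, mul_zero, zero_mul] at hlim
  · have h := (analyticAt_tsum_emRemainder hf hre).continuousAt.tendsto.mono_left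
      (nhdsWithin_le_nhds (s := {(-N : ℂ)}ᶜ))
    have hz : ∀ q, emRemainder f (M + 1) (-N) q = 0 :=
      emRemainder_neg_nat_eq_zero hf (by nlinarith)
    simp only [hz, tsum_zero] at h
    exact h.const_mul _

end

/-! ### Gluing the continuations -/

section

open Polynomial Set Filter Topology

/-- The identity theorem for meromorphic functions. Equality can only be asserted on punctured
neighbourhoods, as the value at a pole is arbitrary. -/
lemma MeromorphicOn.eventuallyEq_nhdsNE_of_isPreconnected {f g : ℂ → ℂ} {U : Set ℂ} {x y : ℂ}
    (hf : MeromorphicOn f U) (hg : MeromorphicOn g U) (hU : IsPreconnected U) (hx : x ∈ U)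
    (hy : y ∈ U) (h : f =ᶠ[𝓝[≠] x] g) : f =ᶠ[𝓝[≠] y] g := by
  have hsub : ∀ z, f =ᶠ[𝓝[≠] z] g ↔ meromorphicOrderAt (f - g) z = ⊤ := fun z => by
    rw [meromorphicOrderAt_eq_top_iff]
    exact eventually_congr (Eventually.of_forall fun w => by simp [sub_eq_zero])
  rw [hsub] at h ⊢
  by_contra hne
  exact MeromorphicOn.meromorphicOrderAt_ne_top_of_isPreconnected (hf.sub hg) hU hy hx hne h

/-- Meromorphic functions on the half-planes `-k < Re z` that agree up to discrete sets glue to one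
meromorphic function on the plane. The function `G k` is used on a vertical strip, and the passage to
the normal form repairs the values on the exceptional set. -/
lemma exists_meromorphicNFOn_univ_of_halfPlanes {G : ℕ → ℂ → ℂ}
    (hG : ∀ (k : ℕ) (z : ℂ), -(k : ℝ) < z.re → MeromorphicAt (G k) z)
    (h : ∀ (k l : ℕ) (z : ℂ), -(k : ℝ) < z.re → -(l : ℝ) < z.re → G k =ᶠ[𝓝[≠] z] G l) :
    ∃ Z : ℂ → ℂ, MeromorphicNFOn Z univ ∧
      ∀ (k : ℕ) (z : ℂ), -(k : ℝ) < z.re → Z =ᶠ[𝓝[≠] z] G k := by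
  set Z₀ : ℂ → ℂ := fun s => G (⌈|s.re|⌉₊ + 1) s with hZ₀
  have key : ∀ (k : ℕ) (z : ℂ), -(k : ℝ) < z.re → Z₀ =ᶠ[𝓝[≠] z] G k := by
    intro k z hk
    -- near `z` only finitely many of the functions `G l` occur in `Z₀`
    have hfin : ∀ᶠ s in 𝓝[≠] z, ∀ l ∈ Finset.range (⌈|z.re|⌉₊ + 3),
        -(l : ℝ) < z.re → G l s = G k s := by
      rw [Filter.eventually_all_finset]
      intro l _
      by_cases hl : -(l : ℝ) < z.re
      · filter_upwards [h l k z hl hk] with s hs _ using hs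
      · exact Eventually.of_forall fun s hs => absurd hs hl
    have hnear : ∀ᶠ s in 𝓝[≠] z, |s.re - z.re| < 1 := by
      refine nhdsWithin_le_nhds (IsOpen.mem_nhds (isOpen_lt (by fun_prop) continuous_const) ?_)
      simp
    filter_upwards [hfin, hnear] with s h1 h2
    have h3 := abs_lt.1 h2
    refine h1 _ (Finset.mem_range.2 ?_) ?_
    · have : ⌈|s.re|⌉₊ ≤ ⌈|z.re|⌉₊ + 1 := by
        rw [Nat.ceil_le]
        push_cast
        have := Nat.le_ceil |z.re|
        have := abs_sub_abs_le_abs_sub s.re z.re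
        linarith
      omega
    · push_cast
      have := Nat.le_ceil |s.re|
      have := neg_abs_le s.re
      linarith
  have hmer : MeromorphicOn Z₀ univ := by
    intro z _
    have hz : -((⌈|z.re|⌉₊ + 1 : ℕ) : ℝ) < z.re := by
      push_cast
      have := Nat.le_ceil |z.re|
      have := neg_abs_le z.re
      linarith
    exact (hG _ z hz).congr (key _ z hz).symm
  exact ⟨toMeromorphicNFOn Z₀ univ, meromorphicNFOn_toMeromorphicNFOn Z₀ univ, fun k z hz =>
    (hmer.toMeromorphicNFOn_eq_self_on_nhdsNE (mem_univ z)).trans (key k z hz)⟩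

lemma isPreconnected_halfPlane (a : ℝ) : IsPreconnected {z : ℂ | a < z.re} :=
  (convex_halfSpace_re_gt a).isPreconnected

lemma isOpen_halfPlane (a : ℝ) : IsOpen {z : ℂ | a < z.re} :=
  isOpen_lt continuous_const Complex.continuous_re

/-- The continuation of the zeta function of `f` to the half-plane `-k < Re s`. The order
`(d + 2) k + 2` of the Euler-Maclaurin expansion is large enough for this half-plane, and, with
`k = N + 1`, for the remainder to vanish at `s = -N`. -/
noncomputable def zetaPolyCont (f : ℝ[X]) (k : ℕ) (s : ℂ) : ℂ :=
  halfCont f ((f.natDegree + 2) * k + 2) s + halfCont f.reverse ((f.natDegree + 2) * k + 2) s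

lemma meromorphicAt_zetaPolyCont {f : ℝ[X]} (hf : ∀ x : ℝ, 0 ≤ x → 0 < f.eval x) (k : ℕ) {s : ℂ}
    (hs : -(k : ℝ) < s.re) : MeromorphicAt (zetaPolyCont f k) s := by
  have h : 2 < ((f.natDegree : ℝ) + 2) * s.re + (((f.natDegree + 2) * k + 2) + 1 : ℕ) := by
    push_cast
    nlinarith [Nat.cast_nonneg (α := ℝ) f.natDegree]
  refine (meromorphicAt_halfCont hf (by omega) h).fun_add
    (meromorphicAt_halfCont (eval_reverse_pos hf) (by omega) ?_)
  rwa [natDegree_reverse_eq hf]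

lemma two_div_lt_of_two_lt (f : ℝ[X]) {s : ℂ} (hs : 2 < s.re) :
    2 / ((f.natDegree : ℝ) + 2) < s.re := by
  refine lt_of_le_of_lt ?_ hs
  exact div_le_self zero_le_two (by linarith [Nat.cast_nonneg (α := ℝ) f.natDegree])

lemma tsum_zetaPolyTerm_eq_zetaPolyCont {f : ℝ[X]} (hf : ∀ x : ℝ, 0 ≤ x → 0 < f.eval x) (k : ℕ)
    {s : ℂ} (hs : 2 < s.re) : ∑' p, zetaPolyTerm f s p = zetaPolyCont f k s := by
  rw [tsum_zetaPolyTerm_eq_halfSum_add_halfSum hf (two_div_lt_of_two_lt f hs),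
    halfSum_eq_halfCont hf _ hs, halfSum_eq_halfCont (eval_reverse_pos hf) _ hs]
  rfl

lemma eventuallyEq_zetaPolyCont {f : ℝ[X]} (hf : ∀ x : ℝ, 0 ≤ x → 0 < f.eval x) {k : ℕ} {Z : ℂ → ℂ}
    (hZ : ∀ z : ℂ, -(k : ℝ) < z.re → MeromorphicAt Z z)
    (h : ∀ s : ℂ, 2 < s.re → Z s = ∑' p, zetaPolyTerm f s p) {z : ℂ} (hz : -(k : ℝ) < z.re) :
    Z =ᶠ[𝓝[≠] z] zetaPolyCont f k := by
  refine MeromorphicOn.eventuallyEq_nhdsNE_of_isPreconnected (U := {w | -(k : ℝ) < w.re})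
    (x := 3) (fun w hw => hZ w hw) (fun w hw => meromorphicAt_zetaPolyCont hf k hw)
    (isPreconnected_halfPlane _) ?_ hz ?_
  · show -(k : ℝ) < (3 : ℂ).re
    have := Nat.cast_nonneg (α := ℝ) k
    norm_num
    linarith
  · refine nhdsWithin_le_nhds ?_
    filter_upwards [(isOpen_halfPlane 2).mem_nhds (show (2 : ℝ) < (3 : ℂ).re by norm_num)]
      with s hs
    rw [h s hs, tsum_zetaPolyTerm_eq_zetaPolyCont hf k hs]

lemma exists_isZetaPoly {f : ℝ[X]} (hf : ∀ x : ℝ, 0 ≤ x → 0 < f.eval x) :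
    ∃ Z : ℂ → ℂ, IsZetaPoly f Z := by
  obtain ⟨Z, hZ, hZG⟩ := exists_meromorphicNFOn_univ_of_halfPlanes (G := zetaPolyCont f)
    (fun k z hz => meromorphicAt_zetaPolyCont hf k hz) (fun k l z hk hl => by
      have hkl : ∀ k l : ℕ, k ≤ l → -(k : ℝ) < z.re →
          zetaPolyCont f l =ᶠ[𝓝[≠] z] zetaPolyCont f k := fun k l hkl hk =>
        eventuallyEq_zetaPolyCont hf (fun w hw => meromorphicAt_zetaPolyCont hf l
          ((neg_le_neg (by exact_mod_cast hkl)).trans_lt hw))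
          (fun s hs => (tsum_zetaPolyTerm_eq_zetaPolyCont hf l hs).symm) hk
      rcases le_total k l with h | h
      · exact (hkl k l h hk).symm
      · exact hkl l k h hl)
  refine ⟨Z, fun s hs => ?_, hZ⟩
  have hS : ∀ w : ℂ, 2 / ((f.natDegree : ℝ) + 2) < w.re →
      AnalyticAt ℂ (fun s => ∑' p, zetaPolyTerm f s p) w := fun w hw =>
    (differentiableOn_tsum_zetaPolyTerm hf).analyticAt ((isOpen_halfPlane _).mem_nhds hw)
  have h1 : (fun s => ∑' p, zetaPolyTerm f s p) =ᶠ[𝓝[≠] s] Z := by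
    refine MeromorphicOn.eventuallyEq_nhdsNE_of_isPreconnected
      (U := {w | 2 / ((f.natDegree : ℝ) + 2) < w.re}) (x := 3)
      (fun w hw => (hS w hw).meromorphicAt) (fun w _ => (hZ (mem_univ w)).meromorphicAt)
      (isPreconnected_halfPlane _) (two_div_lt_of_two_lt f (by norm_num)) hs ?_
    refine EventuallyEq.trans ?_ (hZG 0 3 (by norm_num)).symm
    refine nhdsWithin_le_nhds ?_
    filter_upwards [(isOpen_halfPlane 2).mem_nhds (show (2 : ℝ) < (3 : ℂ).re by norm_num)]
      with w hw using tsum_zetaPolyTerm_eq_zetaPolyCont hf 0 hw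
  have h2 := (((hS s hs).meromorphicNFAt.eventuallyEq_nhdsNE_iff_eventuallyEq_nhds
    (hZ (mem_univ s))).1 h1).eq_of_nhds
  rw [← h2]
  exact (summable_zetaPolyTerm hf hs).hasSum

lemma IsZetaPoly.tendsto_zero {f : ℝ[X]} {Z : ℂ → ℂ} (hZ : IsZetaPoly f Z)
    (hf : ∀ x : ℝ, 0 ≤ x → 0 < f.eval x) (hd : Odd f.natDegree) {N : ℕ} (hN : Odd N) :
    Tendsto Z (𝓝[≠] (-N : ℂ)) (𝓝 0) := by
  have hre : -((N + 1 : ℕ) : ℝ) < (-N : ℂ).re := by simp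
  have h := eventuallyEq_zetaPolyCont hf (k := N + 1)
    (fun z _ => (hZ.meromorphic (mem_univ z)).meromorphicAt)
    (fun s hs => (hZ.hasSum s (two_div_lt_of_two_lt f hs)).tsum_eq.symm) hre
  refine Tendsto.congr' h.symm ?_
  have hM : (f.natDegree + 2) * N + 2 ≤ (f.natDegree + 2) * (N + 1) + 2 := by gcongr; omega
  have h1 := tendsto_halfCont hf hd hN hM
  have h2 := tendsto_halfCont (eval_reverse_pos hf) (natDegree_reverse_eq hf ▸ hd) hN
    (M := (f.natDegree + 2) * (N + 1) + 2) (by rwa [natDegree_reverse_eq hf])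
  simpa using! h1.add h2

end

/-! ### Vanishing at negative odd integers -/

theorem mainTheorem12 (f : Polynomial ℝ) (hf : ∀ x : ℝ, 0 ≤ x → 0 < f.eval x)
    (hd : Odd f.natDegree) :
    (∃ Z : ℂ → ℂ, IsZetaPoly f Z) ∧
      ∀ Z : ℂ → ℂ, IsZetaPoly f Z →
        ∀ n : ℕ, AnalyticAt ℂ Z (-2 * (n : ℂ) - 1) ∧ Z (-2 * (n : ℂ) - 1) = 0 := by
  refine ⟨exists_isZetaPoly hf, fun Z hZ n => ?_⟩
  have e : -2 * (n : ℂ) - 1 = -((2 * n + 1 : ℕ) : ℂ) := by push_cast; ring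
  rw [e]
  -- a function in normal form that tends to `0` is analytic, so its value is that limit
  have hlim := hZ.tendsto_zero hf hd (odd_two_mul_add_one n)
  have hnf := hZ.meromorphic (Set.mem_univ (-((2 * n + 1 : ℕ) : ℂ)))
  have hord := (tendsto_zero_iff_meromorphicOrderAt_pos hnf.meromorphicAt).1 hlim
  have han := hnf.meromorphicOrderAt_nonneg_iff_analyticAt.1 hord.le
  exact ⟨han, tendsto_nhds_unique
    (han.continuousAt.tendsto.mono_left nhdsWithin_le_nhds) hlim⟩
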